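/- Let $A,B$ be finite alphabets with $2\le \mathrm{Card}(B)<\mathrm{Card}(A)$, let $\pi:A\to B$ be a surjective map, and extend it letter by letter to $\pi:A^{\mathbb N}\to B^{\mathbb N}$, $(\pi\boldsymbol a)_n=\pi(\boldsymbol a_n)$. Let $T$ denote the shift, $(T\boldsymbol a)_n=\boldsymbol a_{n+1}$, write $\boldsymbol a_m^n=\boldsymbol a_m\cdots\boldsymbol a_n$, let $[\boldsymbol w]$ be the set of sequences that begin with the word $\boldsymbol w$, and put $S_n\psi=\sum_{k=0}^{n-1}\psi\circ T^k$ and $$\mathrm{var}_n\psi:=\sup\{|\psi(\boldsymbol a)-\psi(\boldsymbol b)|:\ \boldsymbol a_0^n=\boldsymbol b_0^n\}.$$ A potential $\psi:A^{\mathbb N}\to\mathbb R$ is *Hölder continuous* if there are $C>0$ and $\varrho\in(0,1)$ with $\mathrm{var}_n\psi\le C\varrho^n$ for all $n\ge 0$. It is an *$(r+1)$-symbol potential* if $\psi(\boldsymbol a)$ depends only on $\boldsymbol a_0^r$, and *locally constant* if this holds for some $r\in\mathbb N$. A *Gibbs measure* for a continuous potential $\psi$ is a $T$-invariant Borel probability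 measure $\mu$ such that, for some constants $C\ge1$ and $P\in\mathbb R$, $$C^{-1}\le\frac{\mu[\boldsymbol a_0^n]}{\exp(S_{n+1}\psi(\boldsymbol a)-(n+1)P)}\le C\qquad\text{for all } n\in\mathbb N,\ \boldsymbol a .$$ A potential $\psi$ is *normalized* if its topological pressure $\limsup_{n\to\infty}\frac1n\log\sum_{T^n\boldsymbol a=\boldsymbol a}e^{S_n\psi(\boldsymbol a)}$ is $0$. The same definitions are used on $B^{\mathbb N}$. An *$(r+1)$-symbol approximant* of $\psi$ is an $(r+1)$-symbol potential $\psi_r$ with $\|\psi-\psi_r\|_\infty\le\mathrm{var}_r\psi$; for instance $\psi_r(\boldsymbol a)=\max\{\psi(\boldsymbol b):\boldsymbol b_0^r=\boldsymbol a_0^r\}$. **Theorem.** Let $\psi:A^{\mathbb N}\to\mathbb R$ be Hölder continuous and let $\mu_\psi$ be its Gibbs measure. Then there is a potential $\phi:B^{\mathbb N}\to\mathbb R$ with the following properties. 1. The measure $\mu_\psi\circ\pi^{-1}$ is a Gibbs measure for $\phi$, and its support is $B^{\mathbb N}$. 2. There are $\mathcal D,c>0$ such that $\mathrm{var}_n\phi\le\mathcal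 D\exp(-c\sqrt n)$ for all $n\in\mathbb N$. 3. The potential $\phi$ is normalized. For every sequence $(\psi_r)_{r\ge1}$ of $(r+1)$-symbol approximants of $\psi$, with Gibbs measures $\mu_{\psi_r}$ and $\nu_r:=\mu_{\psi_r}\circ\pi^{-1}$, the limits below exist for all $\boldsymbol b\in B^{\mathbb N}$ and $$\phi(\boldsymbol b)=\lim_{r\to\infty}\lim_{n\to\infty}\log\frac{\nu_r[\boldsymbol b_0^n]}{\nu_r[\boldsymbol b_1^n]}.$$ 4. If $\psi$ is locally constant, there are $C>0$ and $\vartheta\in(0,1)$ such that $\mathrm{var}_n\phi\le C\vartheta^n$ for all $n\in\mathbb N$; thus $\phi$ is Hölder continuous. -/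

import Mathlib

open MeasureTheory Filter Topology

namespace Amalgamation

noncomputable section

/-- The shift `(T a)_n = a_{n+1}` on `A^ℕ`. -/
def shift {A : Type*} (a : ℕ → A) : ℕ → A := fun n => a (n + 1)

/-- The letter-by-letter extension `A^ℕ → B^ℕ` of a map `π : A → B`. -/
def amalg {A B : Type*} (π : A → B) (a : ℕ → A) : ℕ → B := fun n => π (a n)

/-- The variation `var_n ψ = sup { |ψ a - ψ b| : a_0^n = b_0^n }`, with values in `[0, ∞]`
so that it is the true supremum for unbounded `ψ` too. -/
def var {A : Type*} (n : ℕ) (ψ : (ℕ → A) → ℝ) : ENNReal :=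
  ⨆ (a : ℕ → A) (b : ℕ → A) (_ : ∀ i ≤ n, a i = b i), ENNReal.ofReal |ψ a - ψ b|

/-- Hölder continuity: the variations decay exponentially. -/
def IsHolder {A : Type*} (ψ : (ℕ → A) → ℝ) : Prop :=
  ∃ C > (0 : ℝ), ∃ ρ ∈ Set.Ioo (0 : ℝ) 1, ∀ n : ℕ, var n ψ ≤ ENNReal.ofReal (C * ρ ^ n)

/-- `ψ` depends on the letters `a_0, …, a_r` only, i.e. it is an `(r+1)`-symbol potential
(without asking that `r` be minimal). -/
def IsSymbolPotential {A : Type*} (r : ℕ) (ψ : (ℕ → A) → ℝ) : Prop :=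
  ∀ a b : ℕ → A, (∀ i ≤ r, a i = b i) → ψ a = ψ b

/-- `ψ` depends on finitely many initial letters only. -/
def IsLocConst {A : Type*} (ψ : (ℕ → A) → ℝ) : Prop :=
  ∃ r : ℕ, IsSymbolPotential r ψ

/-- `ψ'` is an `(r+1)`-symbol approximant of `ψ`: an `(r+1)`-symbol potential with
`‖ψ - ψ'‖ ≤ var_r ψ`. For instance `ψ' a = max { ψ b : b_0^r = a_0^r }` is one. -/
def IsApproximant {A : Type*} (r : ℕ) (ψ ψ' : (ℕ → A) → ℝ) : Prop :=
  IsSymbolPotential r ψ' ∧ ∀ a : ℕ → A, ENNReal.ofReal |ψ a - ψ' a| ≤ var r ψ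

/-- Gibbs measures on the full shift: shift-invariant probability measures `μ` such that
`C⁻¹ ≤ μ[a_0^n] / exp (S_{n+1} ψ(a) - (n+1) P) ≤ C` for some constants `C ≥ 1` and `P`,
for a continuous potential `ψ`. Here `PiNat.cylinder a (n + 1)` is the set of
all sequences that share the letters `0, …, n` with `a`. -/
structure IsGibbs {A : Type*} [TopologicalSpace A] [MeasurableSpace A]
    (μ : Measure (ℕ → A)) (ψ : (ℕ → A) → ℝ) : Prop where
  continuous : Continuous ψ
  isProbabilityMeasure : IsProbabilityMeasure μ
  invariant : MeasurePreserving shift μ μ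
  gibbs : ∃ C ≥ (1 : ℝ), ∃ P : ℝ, ∀ (n : ℕ) (a : ℕ → A),
    μ.real (PiNat.cylinder a (n + 1)) /
        Real.exp (birkhoffSum shift ψ (n + 1) a - (n + 1) * P) ∈ Set.Icc C⁻¹ C

/-- The topological pressure
`limsup_n (1/n) log ∑_{T^n a = a} exp (S_n ψ(a))` on the full shift over a finite alphabet.
For `n ≥ 1` the sum is finite, since there are `(card A)^n` points of period `n`. -/
def pressure {A : Type*} (ψ : (ℕ → A) → ℝ) : EReal :=
  limsup (fun n : ℕ =>
    (((1 / (n : ℝ)) * Real.log (∑ᶠ a ∈ Function.ptsOfPeriod (shift (A := A)) n,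
      Real.exp (birkhoffSum shift ψ n a)) : ℝ) : EReal)) atTop

/-- A potential is normalized if its topological pressure vanishes. -/
def IsNormalized {A : Type*} (ψ : (ℕ → A) → ℝ) : Prop := pressure ψ = 0

/-- `log (ν[b_0^n] / ν[b_1^n])`. The word `b_1^n` consists of the first `n` letters of the
shifted sequence. -/
def logRatio {B : Type*} [MeasurableSpace B] (ν : Measure (ℕ → B)) (b : ℕ → B) (n : ℕ) : ℝ :=
  Real.log (ν.real (PiNat.cylinder b (n + 1)) / ν.real (PiNat.cylinder (shift b) n))

end

end Amalgamation

/-!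
The Gibbs measure `μ` of `ψ` is first shown to be a `g`-measure: with `u = exp ψ` and `L` the
transfer operator of `u`, the functions `u · L^n 1 / (L^{n+1} 1 ∘ T)` converge exponentially fast to
a normalized weight `g = gfun u`, and `∫ L_g F dμ = ∫ F dμ` for all continuous `F`. Hence the mass
of a cylinder under `ν = μ ∘ π⁻¹` is `ν[b_0^n] = ∫ L_{b_n} ⋯ L_{b_0} 1 dμ`, where `L_b` is the transfer
operator of `g` restricted to the letters in the fiber of `b`, and `ν[b_0^n] / ν[b_1^n]` is an
average of the quotients `L_{b_n} ⋯ L_{b_1} (L_{b_0} 1) / L_{b_n} ⋯ L_{b_1} 1`.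

Both limits come from one contraction estimate, `InCone.contraction`. All restricted transfer
operators preserve a cone of functions with log-Hölder distortion, strictly improving its constant.
Therefore two functions of the cone share, after each step, a fixed proportion, and the oscillation
of the quotient of their images decays exponentially, uniformly in the chosen sequence of
restrictions. The limit `ratioLim g π b` of the quotients thus depends exponentially little on the
tail of `b`; its logarithm `φ` has exponentially decaying variations for every Hölder `ψ`, and so
satisfies both the stretched exponential bound and the exponential one. Telescoping gives the Gibbs
property of `ν` with `P = 0`, hence normalization. Since all rates depend only on the bounds of
`ψ`, they are uniform over its approximants, and the limits in `r` and `n` can be interchanged.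

That `μ` is a `g`-measure uses no construction of an eigenmeasure. The Gibbs bounds dominate `μ` by
`D · g^{(n)}` on cylinders (`exists_le_weightProd_gfun`). If `L_g^n F` decays exponentially, this
domination makes `∫ (S_N F)^2 dμ` grow at most linearly, while `∫ S_N F dμ = N ∫ F dμ` by
invariance, so `∫ F dμ = 0` (`integral_eq_zero_of_decay`). Consequently `L_g^n F → ∫ F dμ`.
-/

namespace Amalgamation

noncomputable section

variable {A B : Type*}

/-! ### Sequences and words -/

/-- The sequence `a x_0 x_1 …`. -/
def cons (a : A) (x : ℕ → A) : ℕ → A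
  | 0 => a
  | n + 1 => x n

@[simp] lemma cons_zero (a : A) (x : ℕ → A) : cons a x 0 = a := rfl

@[simp] lemma cons_succ (a : A) (x : ℕ → A) (n : ℕ) : cons a x (n + 1) = x n := rfl

@[simp] lemma shift_cons (a : A) (x : ℕ → A) : shift (cons a x) = x := rfl

lemma cons_head_shift (x : ℕ → A) : cons (x 0) (shift x) = x := by
  funext n; cases n <;> rfl

lemma shift_iterate_apply (k : ℕ) (x : ℕ → A) (i : ℕ) : shift^[k] x i = x (i + k) := by
  induction k generalizing x with
  | zero => rfl
  | succ k ih => rw [Function.iterate_succ_apply, ih]; simp only [shift]; congr 1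

/-- The sequence `w_0 … w_{n-1} x_0 x_1 …`. -/
def app {n : ℕ} (w : Fin n → A) (x : ℕ → A) : ℕ → A :=
  fun i => if h : i < n then w ⟨i, h⟩ else x (i - n)

lemma app_of_lt {n : ℕ} (w : Fin n → A) (x : ℕ → A) {i : ℕ} (h : i < n) :
    app w x i = w ⟨i, h⟩ := by simp [app, h]

lemma app_zero (w : Fin 0 → A) (x : ℕ → A) : app w x = x := by
  funext i; simp [app]

lemma app_cons {n : ℕ} (a : A) (w : Fin n → A) (x : ℕ → A) :
    app (Fin.cons a w : Fin (n + 1) → A) x = cons a (app w x) := by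
  funext i
  cases i with
  | zero => simp [app]
  | succ i =>
    by_cases h : i < n
    · rw [app_of_lt _ _ (Nat.succ_lt_succ h), cons_succ, app_of_lt _ _ h]
      rfl
    · simp [app, h]

lemma sum_fin_succ_words [Fintype A] {n : ℕ} (F : (Fin (n + 1) → A) → ℝ) :
    ∑ w, F w = ∑ w : Fin n → A, ∑ a : A, F (Fin.cons a w) := by
  rw [← (Fin.consEquiv (fun _ : Fin (n + 1) => A)).sum_comp, Fintype.sum_prod_type,
    Finset.sum_comm]
  rfl

/-! ### Transfer operators restricted to subsets of the alphabet -/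

/-- The transfer operator with weight `u` that sums over the preimages `a x` with `a ∈ S`. -/
def transfer (u : (ℕ → A) → ℝ) (S : Finset A) (f : (ℕ → A) → ℝ) : (ℕ → A) → ℝ :=
  fun x => ∑ a ∈ S, u (cons a x) * f (cons a x)

/-- The composition `L_{S (n-1)} ∘ ⋯ ∘ L_{S 0}` of restricted transfer operators. -/
def iter (u : (ℕ → A) → ℝ) (S : ℕ → Finset A) : ℕ → ((ℕ → A) → ℝ) → (ℕ → A) → ℝ
  | 0, f => f
  | n + 1, f => transfer u (S n) (iter u S n f)

lemma iter_succ' (u : (ℕ → A) → ℝ) (S : ℕ → Finset A) (n : ℕ) (f : (ℕ → A) → ℝ) :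
    iter u S (n + 1) f = iter u (shift S) n (transfer u (S 0) f) := by
  induction n with
  | zero => rfl
  | succ n ih => rw [iter, ih]; rfl

/-- The composition of the first `n` operators depends on the first `n` sets only. -/
lemma iter_congr {u : (ℕ → A) → ℝ} {S S' : ℕ → Finset A} {n : ℕ} (h : ∀ i < n, S i = S' i)
    (f : (ℕ → A) → ℝ) : iter u S n f = iter u S' n f := by
  induction n with
  | zero => rfl
  | succ n ih =>
    rw [iter, iter, ih fun i hi => h i (by omega), h n (by omega)]

/-- A weight bounded away from `0` and `∞` by `δ` and `δ⁻¹`, whose logarithm has variations at most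
`C ρ ^ n`. -/
structure IsWeight (δ C ρ : ℝ) (u : (ℕ → A) → ℝ) : Prop where
  δ_pos : 0 < δ
  C_nonneg : 0 ≤ C
  ρ_pos : 0 < ρ
  ρ_lt : ρ < 1
  lower : ∀ x, δ ≤ u x
  upper : ∀ x, u x ≤ δ⁻¹
  distortion : ∀ n x y, (∀ i ≤ n, x i = y i) → u x ≤ Real.exp (C * ρ ^ n) * u y

lemma IsWeight.pos {δ C ρ : ℝ} {u : (ℕ → A) → ℝ} (hu : IsWeight δ C ρ u) (x) : 0 < u x :=
  hu.δ_pos.trans_le (hu.lower x)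

/-- The cone of nonnegative functions whose logarithm oscillates by at most `K ρ ^ n` on cylinders
of length `n`. -/
structure InCone (K ρ : ℝ) (f : (ℕ → A) → ℝ) : Prop where
  nonneg : ∀ x, 0 ≤ f x
  le : ∀ n x y, (∀ i < n, x i = y i) → f x ≤ Real.exp (K * ρ ^ n) * f y

lemma inCone_one {K ρ : ℝ} (hK : 0 ≤ K) (hρ : 0 ≤ ρ) : InCone K ρ (fun _ : ℕ → A => 1) where
  nonneg _ := zero_le_one
  le n x y _ := by
    rw [mul_one]
    exact Real.one_le_exp (by positivity)

lemma InCone.mono {K K' ρ : ℝ} {f : (ℕ → A) → ℝ} (hf : InCone K ρ f) (hρ : 0 ≤ ρ) (h : K ≤ K') :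
    InCone K' ρ f where
  nonneg := hf.nonneg
  le n x y hxy := (hf.le n x y hxy).trans <| by
    have := hf.nonneg y
    gcongr

lemma InCone.le_all {K ρ : ℝ} {f : (ℕ → A) → ℝ} (hf : InCone K ρ f) (x y : ℕ → A) :
    f x ≤ Real.exp K * f y := by
  simpa using hf.le 0 x y (by simp)

section cone

variable {δ C ρ K : ℝ} {u : (ℕ → A) → ℝ}

lemma transfer_mono (hu : IsWeight δ C ρ u) {S : Finset A} {f g : (ℕ → A) → ℝ}
    (h : ∀ x, f x ≤ g x) (x : ℕ → A) : transfer u S f x ≤ transfer u S g x :=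
  Finset.sum_le_sum fun _ _ => mul_le_mul_of_nonneg_left (h _) (hu.pos _).le

lemma transfer_pos (hu : IsWeight δ C ρ u) {S : Finset A} (hS : S.Nonempty) {f : (ℕ → A) → ℝ}
    (h : ∀ x, 0 < f x) (x : ℕ → A) : 0 < transfer u S f x :=
  Finset.sum_pos (fun _ _ => mul_pos (hu.pos _) (h _)) hS

lemma transfer_smul (S : Finset A) (c : ℝ) (f : (ℕ → A) → ℝ) :
    transfer u S (fun x => c * f x) = fun x => c * transfer u S f x := by
  funext x
  simp only [transfer, Finset.mul_sum]
  exact Finset.sum_congr rfl fun a _ => by ring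

lemma transfer_sub (S : Finset A) (f g : (ℕ → A) → ℝ) :
    transfer u S (fun x => f x - g x) = fun x => transfer u S f x - transfer u S g x := by
  funext x
  simp only [transfer, ← Finset.sum_sub_distrib]
  exact Finset.sum_congr rfl fun a _ => by ring

lemma transfer_add (S : Finset A) (f g : (ℕ → A) → ℝ) :
    transfer u S (fun x => f x + g x) = fun x => transfer u S f x + transfer u S g x := by
  funext x
  simp only [transfer, ← Finset.sum_add_distrib]
  exact Finset.sum_congr rfl fun a _ => by ring

lemma iter_mono (hu : IsWeight δ C ρ u) {S : ℕ → Finset A} {f g : (ℕ → A) → ℝ}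
    (h : ∀ x, f x ≤ g x) (n : ℕ) (x : ℕ → A) : iter u S n f x ≤ iter u S n g x := by
  induction n generalizing x with
  | zero => exact h x
  | succ n ih => exact transfer_mono hu ih x

lemma iter_pos (hu : IsWeight δ C ρ u) {S : ℕ → Finset A} (hS : ∀ n, (S n).Nonempty)
    {f : (ℕ → A) → ℝ} (h : ∀ x, 0 < f x) (n : ℕ) (x : ℕ → A) : 0 < iter u S n f x := by
  induction n generalizing x with
  | zero => exact h x
  | succ n ih => exact transfer_pos hu (hS n) ih x

lemma iter_smul (S : ℕ → Finset A) (n : ℕ) (c : ℝ) (f : (ℕ → A) → ℝ) :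
    iter u S n (fun x => c * f x) = fun x => c * iter u S n f x := by
  induction n with
  | zero => rfl
  | succ n ih => rw [iter, ih, transfer_smul]; rfl

lemma iter_sub (S : ℕ → Finset A) (n : ℕ) (f g : (ℕ → A) → ℝ) :
    iter u S n (fun x => f x - g x) = fun x => iter u S n f x - iter u S n g x := by
  induction n with
  | zero => rfl
  | succ n ih => rw [iter, ih, transfer_sub]; rfl

lemma iter_add (S : ℕ → Finset A) (n : ℕ) (f g : (ℕ → A) → ℝ) :
    iter u S n (fun x => f x + g x) = fun x => iter u S n f x + iter u S n g x := by
  induction n with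
  | zero => rfl
  | succ n ih => rw [iter, ih, transfer_add]; rfl

/-- A transfer operator improves the distortion constant `K` by the factor `(1 + ρ) / 2`. -/
lemma InCone.transfer (hu : IsWeight δ C ρ u) (hK : 2 * C ≤ (1 - ρ) * K) {f : (ℕ → A) → ℝ}
    (hf : InCone K ρ f) (S : Finset A) : InCone ((1 + ρ) / 2 * K) ρ (transfer u S f) where
  nonneg x := Finset.sum_nonneg fun a _ => mul_nonneg (hu.pos _).le (hf.nonneg _)
  le n x y hxy := by
    simp only [Amalgamation.transfer, Finset.mul_sum]
    refine Finset.sum_le_sum fun a _ => ?_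
    have h1 : u (cons a x) ≤ Real.exp (C * ρ ^ n) * u (cons a y) := by
      refine hu.distortion n _ _ fun i hi => ?_
      cases i with
      | zero => rfl
      | succ i => exact hxy i (by omega)
    have h2 : f (cons a x) ≤ Real.exp (K * ρ ^ (n + 1)) * f (cons a y) := by
      refine hf.le (n + 1) _ _ fun i hi => ?_
      cases i with
      | zero => rfl
      | succ i => exact hxy i (by omega)
    have h3 : Real.exp (C * ρ ^ n) * Real.exp (K * ρ ^ (n + 1)) ≤
        Real.exp ((1 + ρ) / 2 * K * ρ ^ n) := by
      rw [← Real.exp_add, Real.exp_le_exp, pow_succ]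
      have := pow_pos hu.ρ_pos n
      nlinarith
    have hy := hf.nonneg (cons a y)
    have uy := (hu.pos (cons a y)).le
    calc u (cons a x) * f (cons a x)
        ≤ (Real.exp (C * ρ ^ n) * u (cons a y)) * (Real.exp (K * ρ ^ (n + 1)) * f (cons a y)) :=
          mul_le_mul h1 h2 (hf.nonneg _) (by positivity)
      _ = (Real.exp (C * ρ ^ n) * Real.exp (K * ρ ^ (n + 1))) * (u (cons a y) * f (cons a y)) := by
          ring
      _ ≤ _ := mul_le_mul_of_nonneg_right h3 (by positivity)

lemma IsWeight.K_nonneg (hu : IsWeight δ C ρ u) (hK : 2 * C ≤ (1 - ρ) * K) : 0 ≤ K := by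
  have h1 := hu.C_nonneg
  have h2 := hu.ρ_lt
  by_contra! h
  nlinarith

lemma InCone.transfer' (hu : IsWeight δ C ρ u) (hK : 2 * C ≤ (1 - ρ) * K) {f : (ℕ → A) → ℝ}
    (hf : InCone K ρ f) (S : Finset A) : InCone K ρ (Amalgamation.transfer u S f) := by
  refine (hf.transfer hu hK S).mono hu.ρ_pos.le ?_
  have := hu.ρ_lt
  have := hu.K_nonneg hK
  nlinarith

lemma InCone.iter (hu : IsWeight δ C ρ u) (hK : 2 * C ≤ (1 - ρ) * K) {f : (ℕ → A) → ℝ}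
    (hf : InCone K ρ f) (S : ℕ → Finset A) (n : ℕ) : InCone K ρ (iter u S n f) := by
  induction n with
  | zero => exact hf
  | succ n ih => exact ih.transfer' hu hK (S n)

/-- In the cone with the improved constant, a fixed proportion of a smaller function can be
subtracted without leaving the original cone. -/
lemma InCone.sub (hρ0 : 0 < ρ) (hρ : ρ < 1) (hK : 0 ≤ K) {f g : (ℕ → A) → ℝ}
    (hf : InCone ((1 + ρ) / 2 * K) ρ f) (hg : InCone ((1 + ρ) / 2 * K) ρ g)
    {s : ℝ} (hs : 0 ≤ s)
    (hsg : ∀ x, s * g x ≤ (1 - ρ) / (3 + ρ) * Real.exp (-K) * f x) :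
    InCone K ρ (fun x => f x - s * g x) := by
  have hη : (1 - ρ) / (3 + ρ) * Real.exp (-K) ≤ 1 := by
    have h1 : (1 - ρ) / (3 + ρ) ≤ 1 := by rw [div_le_one (by linarith)]; linarith
    have h2 : Real.exp (-K) ≤ 1 := Real.exp_le_one_iff.2 (by linarith)
    have h3 : 0 ≤ (1 - ρ) / (3 + ρ) := div_nonneg (by linarith) (by linarith)
    nlinarith [Real.exp_pos (-K)]
  refine ⟨fun x => ?_, fun n x y hxy => ?_⟩
  · have := hsg x
    nlinarith [hf.nonneg x]
  set t := ρ ^ n with ht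
  have ht0 : 0 < t := pow_pos hρ0 n
  have ht1 : t ≤ 1 := pow_le_one₀ hρ0.le hρ.le
  have h1 := hf.le n x y hxy
  have h2 := hg.le n y x fun i hi => (hxy i hi).symm
  rw [← ht] at h1 h2
  set σ := (1 + ρ) / 2 with hσ
  have h3 : Real.exp (-(σ * K * t)) * g y ≤ g x := by
    calc _ ≤ Real.exp (-(σ * K * t)) * (Real.exp (σ * K * t) * g x) := by gcongr
      _ = g x := by rw [← mul_assoc, ← Real.exp_add]; simp
  -- the elementary inequality between the two gaps of exponentials
  have h4 : (1 - ρ) / (3 + ρ) * Real.exp (-K) *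
      (Real.exp (K * t) - Real.exp (-(σ * K * t))) ≤ Real.exp (K * t) - Real.exp (σ * K * t) := by
    have e1 : (1 - σ) * K * t ≤ Real.exp (K * t) - Real.exp (σ * K * t) := by
      have a1 : Real.exp (K * t) = Real.exp (σ * K * t) * Real.exp ((1 - σ) * K * t) := by
        rw [← Real.exp_add]; ring_nf
      have a2 := Real.add_one_le_exp ((1 - σ) * K * t)
      have a3 : 1 ≤ Real.exp (σ * K * t) := Real.one_le_exp (by positivity)
      have a4 : 0 ≤ (1 - σ) * K * t :=
        mul_nonneg (mul_nonneg (by rw [hσ]; linarith) hK) ht0.le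
      rw [a1]
      nlinarith
    have e2 : Real.exp (K * t) - Real.exp (-(σ * K * t)) ≤ Real.exp K * ((1 + σ) * K * t) := by
      have a1 : Real.exp (-(σ * K * t)) = Real.exp (K * t) * Real.exp (-((1 + σ) * K * t)) := by
        rw [← Real.exp_add]; ring_nf
      have a2 := Real.add_one_le_exp (-((1 + σ) * K * t))
      have a3 : Real.exp (K * t) ≤ Real.exp K := Real.exp_le_exp.2 (by nlinarith)
      have a4 : 0 ≤ (1 + σ) * K * t := by positivity
      rw [a1]
      nlinarith [Real.exp_pos (K * t)]
    have e3 : (1 - ρ) / (3 + ρ) * (1 + σ) = 1 - σ := by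
      have : (3 + ρ) ≠ 0 := by linarith
      rw [hσ]; field_simp; ring
    have e4 : 0 ≤ (1 - ρ) / (3 + ρ) := div_nonneg (by linarith) (by linarith)
    calc _ ≤ (1 - ρ) / (3 + ρ) * Real.exp (-K) * (Real.exp K * ((1 + σ) * K * t)) := by gcongr
      _ = (Real.exp (-K) * Real.exp K) * ((1 - ρ) / (3 + ρ) * (1 + σ)) * K * t := by ring
      _ = (1 - σ) * K * t := by rw [e3, ← Real.exp_add]; simp
      _ ≤ _ := e1
  have h5 : s * (Real.exp (-(σ * K * t)) * g y) ≤ s * g x := by gcongr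
  have h6 : 0 ≤ Real.exp (K * t) - Real.exp (-(σ * K * t)) := by
    rw [sub_nonneg, Real.exp_le_exp]
    have : 0 ≤ K * t := by positivity
    have : 0 ≤ σ * K * t := by positivity
    linarith
  have h7 := mul_le_mul_of_nonneg_right (hsg y) h6
  have h8 := mul_le_mul_of_nonneg_right h4 (hf.nonneg y)
  show f x - s * g x ≤ _ * (f y - s * g y)
  nlinarith

/-- The contraction rate of restricted transfer operators on the cone with constants `K`, `ρ`: the
common part `s g` has `s ≥ (1 - ρ) / (3 + ρ) * exp (-3 K) * q`, where `q` is a value of the quotient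
`f / g`, whose supremum is at most `exp (2 K) * q`. -/
def rate (K ρ : ℝ) : ℝ := 1 - (1 - ρ) / (3 + ρ) * Real.exp (-5 * K)

lemma rate_lt_one (hρ0 : 0 < ρ) (hρ : ρ < 1) : rate K ρ < 1 := by
  have : 0 < (1 - ρ) / (3 + ρ) := div_pos (by linarith) (by linarith)
  have := mul_pos this (Real.exp_pos (-5 * K))
  unfold rate
  linarith

lemma rate_pos (hρ0 : 0 < ρ) (hρ : ρ < 1) (hK : 0 ≤ K) : 0 < rate K ρ := by
  have h1 : (1 - ρ) / (3 + ρ) < 1 := by rw [div_lt_one (by linarith)]; linarith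
  have h2 : Real.exp (-5 * K) ≤ 1 := Real.exp_le_one_iff.2 (by linarith)
  have h3 : 0 ≤ (1 - ρ) / (3 + ρ) := div_nonneg (by linarith) (by linarith)
  unfold rate
  nlinarith [Real.exp_pos (-5 * K)]

lemma tendsto_rate_pow (hu : IsWeight δ C ρ u) (hK : 2 * C ≤ (1 - ρ) * K) (c : ℝ) :
    Tendsto (fun n : ℕ => c * rate K ρ ^ n) atTop (𝓝 0) := by
  simpa using (tendsto_pow_atTop_nhds_zero_of_lt_one
    (rate_pos hu.ρ_pos hu.ρ_lt (hu.K_nonneg hK)).le (rate_lt_one hu.ρ_pos hu.ρ_lt)).const_mul c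

/-- **Contraction.** Each operator makes `f` and `g` share a common part `s g` which is a fixed
proportion of `f`; what remains of `f` is again in the cone, so the spread of `f / g` decays
exponentially, at a rate which does not depend on the operators. -/
theorem InCone.contraction (hu : IsWeight δ C ρ u) (hK : 2 * C ≤ (1 - ρ) * K)
    {S : ℕ → Finset A} (hS : ∀ n, (S n).Nonempty) (n : ℕ) {f g : (ℕ → A) → ℝ}
    (hf : InCone K ρ f) (hg : InCone K ρ g) (hg0 : ∀ x, 0 < g x) {β : ℝ}
    (hβ : ∀ x, f x ≤ β * g x) :
    ∃ s, ∀ x, s * Amalgamation.iter u S n g x ≤ Amalgamation.iter u S n f x ∧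
      Amalgamation.iter u S n f x ≤
        (s + rate K ρ ^ n * β) * Amalgamation.iter u S n g x := by
  induction n generalizing f g β S with
  | zero =>
    exact ⟨0, fun x => ⟨by simpa [Amalgamation.iter] using hf.nonneg x,
      by simpa [Amalgamation.iter] using hβ x⟩⟩
  | succ n ih =>
    have hK0 := hu.K_nonneg hK
    rcases isEmpty_or_nonempty (ℕ → A) with hA | ⟨⟨x₀⟩⟩
    · exact ⟨0, fun x => (hA.false x).elim⟩
    set f₁ := Amalgamation.transfer u (S 0) f with hf₁
    set g₁ := Amalgamation.transfer u (S 0) g with hg₁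
    have cf := hf.transfer hu hK (S 0)
    have cg := hg.transfer hu hK (S 0)
    have cf' := hf.transfer' hu hK (S 0)
    have cg' := hg.transfer' hu hK (S 0)
    rw [← hf₁] at cf cf'
    rw [← hg₁] at cg cg'
    have g₁pos : ∀ x, 0 < g₁ x := transfer_pos hu (hS 0) hg0
    have hβ₁ : ∀ x, f₁ x ≤ β * g₁ x := fun x => by
      have := transfer_mono hu (S := S 0) hβ x
      rwa [transfer_smul] at this
    set q := f₁ x₀ / g₁ x₀ with hq
    have hq0 : 0 ≤ q := div_nonneg (cf.nonneg _) (g₁pos _).le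
    have hqf : f₁ x₀ = q * g₁ x₀ := by rw [hq]; field_simp [(g₁pos x₀).ne']
    have hqβ : q ≤ β := by rw [hq, div_le_iff₀ (g₁pos _)]; exact hβ₁ x₀
    have hup : ∀ x, f₁ x ≤ Real.exp (2 * K) * q * g₁ x := fun x => by
      have h1 := cf'.le_all x x₀
      have h2 := cg'.le_all x₀ x
      calc f₁ x ≤ Real.exp K * (q * g₁ x₀) := by rw [← hqf]; exact h1
        _ ≤ Real.exp K * (q * (Real.exp K * g₁ x)) := by gcongr
        _ = (Real.exp K * Real.exp K) * q * g₁ x := by ring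
        _ = _ := by rw [← Real.exp_add]; ring_nf
    have hlow : ∀ x, Real.exp (-2 * K) * q * g₁ x ≤ f₁ x := fun x => by
      have h1 := cf'.le_all x₀ x
      have h2 := cg'.le_all x x₀
      calc Real.exp (-2 * K) * q * g₁ x ≤ Real.exp (-2 * K) * q * (Real.exp K * g₁ x₀) := by gcongr
        _ = Real.exp (-2 * K) * Real.exp K * f₁ x₀ := by rw [hqf]; ring
        _ ≤ Real.exp (-2 * K) * Real.exp K * (Real.exp K * f₁ x) := by gcongr
        _ = (Real.exp (-2 * K) * Real.exp K * Real.exp K) * f₁ x := by ring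
        _ = f₁ x := by rw [← Real.exp_add, ← Real.exp_add]; ring_nf; simp
    set η := (1 - ρ) / (3 + ρ) with hη
    have hη0 : 0 ≤ η := div_nonneg (by linarith [hu.ρ_lt]) (by linarith [hu.ρ_pos])
    -- `f₁ ≥ exp (-2 K) q g₁`, so `InCone.sub` allows the multiple `η exp (-K) exp (-2 K) q` of `g₁`
    set s := η * Real.exp (-3 * K) * q with hs
    have hs0 : 0 ≤ s := by positivity
    have hsub : InCone K ρ (fun x => f₁ x - s * g₁ x) := by
      refine cf.sub hu.ρ_pos hu.ρ_lt hK0 cg hs0 fun x => ?_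
      calc s * g₁ x = η * Real.exp (-K) * (Real.exp (-2 * K) * q * g₁ x) := by
            have : Real.exp (-3 * K) = Real.exp (-K) * Real.exp (-2 * K) := by
              rw [← Real.exp_add]; ring_nf
            rw [hs, this]; ring
        _ ≤ _ := by gcongr; exact hlow x
    have hrem : ∀ x, f₁ x - s * g₁ x ≤ (rate K ρ * β) * g₁ x := fun x => by
      have key : η * Real.exp (-5 * K) * (Real.exp (2 * K) * q) = s := by
        have : Real.exp (-3 * K) = Real.exp (-5 * K) * Real.exp (2 * K) := by
          rw [← Real.exp_add]; ring_nf
        rw [hs, this]; ring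
      have hr0 := (rate_pos hu.ρ_pos hu.ρ_lt hK0 (K := K)).le
      have hr : rate K ρ = 1 - η * Real.exp (-5 * K) := rfl
      -- the smaller of the two upper bounds `β` and `exp (2 K) q` of `f₁ / g₁` is used
      rcases le_total β (Real.exp (2 * K) * q) with h | h
      · have h1 : η * Real.exp (-5 * K) * β ≤ s := by
          rw [← key]; gcongr
        have h2 := hβ₁ x
        have h3 := mul_le_mul_of_nonneg_right h1 (g₁pos x).le
        rw [hr]
        linarith
      · have h2 := hup x
        calc f₁ x - s * g₁ x ≤ (Real.exp (2 * K) * q - s) * g₁ x := by linarith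
          _ = rate K ρ * (Real.exp (2 * K) * q) * g₁ x := by rw [hr, ← key]; ring
          _ ≤ _ := by have := (g₁pos x).le; gcongr
    obtain ⟨s', hs'⟩ := ih (S := shift S) (fun n => hS (n + 1)) hsub cg' g₁pos hrem
    refine ⟨s + s', fun x => ?_⟩
    have := hs' x
    rw [iter_sub, iter_smul] at this
    rw [iter_succ', iter_succ', ← hf₁, ← hg₁, pow_succ]
    constructor <;> linarith [this.1, this.2]

/-- The quotients `(L^m f) / (L^m g)` are within `rate ^ n * β` of each other once `m ≥ n`. -/
lemma InCone.abs_ratio_sub_le (hu : IsWeight δ C ρ u) (hK : 2 * C ≤ (1 - ρ) * K)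
    {S S' : ℕ → Finset A} (hS : ∀ n, (S n).Nonempty) (hS' : ∀ n, (S' n).Nonempty) {n : ℕ}
    (hSS' : ∀ i < n, S i = S' i) {f g : (ℕ → A) → ℝ}
    (hf : InCone K ρ f) (hg : InCone K ρ g) (hg0 : ∀ x, 0 < g x) {β : ℝ}
    (hβ : ∀ x, f x ≤ β * g x) {m m' : ℕ} (hm : n ≤ m) (hm' : n ≤ m') (x y : ℕ → A) :
    |Amalgamation.iter u S m f x / Amalgamation.iter u S m g x -
      Amalgamation.iter u S' m' f y / Amalgamation.iter u S' m' g y| ≤ rate K ρ ^ n * β := by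
  obtain ⟨s, hs⟩ := hf.contraction hu hK hS n hg hg0 hβ
  have aux : ∀ (S' : ℕ → Finset A), (∀ n, (S' n).Nonempty) → (∀ i < n, S i = S' i) →
      ∀ m, n ≤ m → ∀ x, s * Amalgamation.iter u S' m g x ≤ Amalgamation.iter u S' m f x ∧
      Amalgamation.iter u S' m f x ≤
        (s + rate K ρ ^ n * β) * Amalgamation.iter u S' m g x := by
    intro S' hS' hSS' m hm
    induction m, hm using Nat.le_induction with
    | base => rw [← iter_congr hSS', ← iter_congr hSS']; exact hs
    | succ m hm ih =>
      intro x
      have h1 := transfer_mono hu (S := S' m) (fun x => (ih x).1) x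
      have h2 := transfer_mono hu (S := S' m) (fun x => (ih x).2) x
      rw [transfer_smul] at h1 h2
      exact ⟨h1, h2⟩
  have h1 := aux S hS (fun _ _ => rfl) m hm x
  have h2 := aux S' hS' hSS' m' hm' y
  have p1 := iter_pos hu hS hg0 m x
  have p2 := iter_pos hu hS' hg0 m' y
  rw [← le_div_iff₀ p1, ← div_le_iff₀ p1] at h1
  rw [← le_div_iff₀ p2, ← div_le_iff₀ p2] at h2
  rw [abs_le]
  constructor <;> linarith [h1.1, h1.2, h2.1, h2.2]

end cone

/-! ### The full transfer operator and sums over words -/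

/-- The `n`-th power of the full transfer operator. -/
abbrev ruelle [Fintype A] (u : (ℕ → A) → ℝ) (n : ℕ) (f : (ℕ → A) → ℝ) : (ℕ → A) → ℝ :=
  iter u (fun _ => Finset.univ) n f

/-- The product of the weight `u` along the first `n` points of the orbit of `x`. -/
def weightProd (u : (ℕ → A) → ℝ) (n : ℕ) (x : ℕ → A) : ℝ :=
  ∏ k ∈ Finset.range n, u (shift^[k] x)

lemma weightProd_succ_cons (u : (ℕ → A) → ℝ) (n : ℕ) (a : A) (x : ℕ → A) :
    weightProd u (n + 1) (cons a x) = weightProd u n x * u (cons a x) := by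
  simp [weightProd, Finset.prod_range_succ']

lemma weightProd_exp (ψ : (ℕ → A) → ℝ) (n : ℕ) (x : ℕ → A) :
    weightProd (fun y => Real.exp (ψ y)) n x = Real.exp (birkhoffSum shift ψ n x) := by
  rw [weightProd, birkhoffSum, Real.exp_sum]

section

variable [Fintype A]

lemma ruelle_eq_sum (u : (ℕ → A) → ℝ) (n : ℕ) (F : (ℕ → A) → ℝ) (x : ℕ → A) :
    ruelle u n F x = ∑ w : Fin n → A, weightProd u n (app w x) * F (app w x) := by
  induction n generalizing F with
  | zero => simp [ruelle, iter, weightProd, app_zero]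
  | succ n ih =>
    rw [ruelle, iter_succ', sum_fin_succ_words]
    refine (ih _).trans (Finset.sum_congr rfl fun w _ => ?_)
    simp only [transfer, Finset.mul_sum, app_cons, weightProd_succ_cons]
    exact Finset.sum_congr rfl fun a _ => by ring

lemma ruelle_add (u : (ℕ → A) → ℝ) (m n : ℕ) (f : (ℕ → A) → ℝ) :
    ruelle u m (ruelle u n f) = ruelle u (m + n) f := by
  induction m with
  | zero => simp [iter]
  | succ m ih =>
    rw [Nat.add_right_comm]
    change transfer u _ (ruelle u m (ruelle u n f)) = transfer u _ (ruelle u (m + n) f)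
    rw [ih]

lemma ruelle_comp_shift (u F G : (ℕ → A) → ℝ) (n : ℕ) :
    ruelle u n (fun x => G x * F (shift^[n] x)) = fun x => F x * ruelle u n G x := by
  induction n generalizing F with
  | zero => funext x; simp [iter, mul_comm]
  | succ n ih =>
    have := ih (fun x => F (shift x))
    simp only [Function.iterate_succ_apply']
    change transfer u _ (ruelle u n _) = fun x => F x * transfer u _ (ruelle u n G) x
    rw [this]
    funext x
    simp only [transfer, shift_cons, Finset.mul_sum]
    exact Finset.sum_congr rfl fun a _ => by ring

end

section words

variable [Fintype A] [TopologicalSpace A] [DiscreteTopology A] [MeasurableSpace A] [BorelSpace A]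

lemma measurableSet_cylinder (x : ℕ → A) (n : ℕ) : MeasurableSet (PiNat.cylinder x n) :=
  (PiNat.isOpen_cylinder _ x n).measurableSet

/-- A function of the first `n` letters is integrated by summing over words of length `n`. -/
lemma integral_eq_sum (μ : Measure (ℕ → A)) [IsProbabilityMeasure μ] (n : ℕ) (x : ℕ → A)
    {F : (ℕ → A) → ℝ} (hF : ∀ y z, (∀ i < n, y i = z i) → F y = F z) :
    ∫ y, F y ∂μ = ∑ w : Fin n → A, F (app w x) * μ.real (PiNat.cylinder (app w x) n) := by
  classical
  have h : F = fun y => ∑ w : Fin n → A,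
      (PiNat.cylinder (app w x) n).indicator (fun _ => F (app w x)) y := by
    funext y
    rw [Finset.sum_eq_single (fun i : Fin n => y i)]
    · have hy : ∀ i < n, y i = app (fun i : Fin n => y i) x i := fun i hi => by
        rw [app_of_lt _ _ hi]
      rw [Set.indicator_of_mem (by exact hy)]
      exact hF _ _ hy
    · intro w _ hw
      refine Set.indicator_of_notMem (fun hy => hw ?_) _
      funext i
      have := hy i i.2
      rw [app_of_lt _ _ i.2] at this
      exact this.symm
    · simp
  conv_lhs => rw [h]
  rw [integral_finsetSum]
  · refine Finset.sum_congr rfl fun w _ => ?_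
    rw [integral_indicator_const _ (measurableSet_cylinder _ _), smul_eq_mul, mul_comm]
  · exact fun w _ => (integrable_const _).indicator (measurableSet_cylinder _ _)

lemma sum_cylinder (μ : Measure (ℕ → A)) [IsProbabilityMeasure μ] (n : ℕ) (x : ℕ → A) :
    ∑ w : Fin n → A, μ.real (PiNat.cylinder (app w x) n) = 1 := by
  have := integral_eq_sum μ n x (F := fun _ => 1) (fun _ _ _ => rfl)
  simpa using this.symm

end words

/-! ### The normalized weight -/

section gfun

variable [Fintype A] {δ C ρ K : ℝ} {u : (ℕ → A) → ℝ}

/-- The approximations `u · L^n 1 / (L^{n+1} 1 ∘ T)` of the normalized weight. -/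
def gApprox (u : (ℕ → A) → ℝ) (n : ℕ) (x : ℕ → A) : ℝ :=
  u x * ruelle u n (fun _ => 1) x / ruelle u (n + 1) (fun _ => 1) (shift x)

/-- The normalized weight (`g`-function) cohomologous to `u` up to a constant. -/
def gfun (u : (ℕ → A) → ℝ) (x : ℕ → A) : ℝ := limUnder atTop fun n => gApprox u n x

lemma inCone_ruelle_one (hu : IsWeight δ C ρ u) (hK : 2 * C ≤ (1 - ρ) * K) (n : ℕ) :
    InCone K ρ (ruelle u n (fun _ => 1)) :=
  (inCone_one (hu.K_nonneg hK) hu.ρ_pos.le).iter hu hK _ n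

lemma ruelle_one_pos (hu : IsWeight δ C ρ u) [Nonempty A] (n : ℕ) (x : ℕ → A) :
    0 < ruelle u n (fun _ => 1) x :=
  iter_pos hu (fun _ => Finset.univ_nonempty) (fun _ => one_pos) n x

variable [Nonempty A]

lemma gApprox_pos (hu : IsWeight δ C ρ u) (n : ℕ) (x : ℕ → A) : 0 < gApprox u n x :=
  div_pos (mul_pos (hu.pos _) (ruelle_one_pos hu _ _)) (ruelle_one_pos hu _ _)

lemma sum_gApprox (hu : IsWeight δ C ρ u) (n : ℕ) (x : ℕ → A) :
    ∑ a, gApprox u n (cons a x) = 1 := by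
  simp only [gApprox, shift_cons, ← Finset.sum_div]
  exact div_self (ruelle_one_pos hu (n + 1) x).ne'

lemma gApprox_le_one (hu : IsWeight δ C ρ u) (n : ℕ) (x : ℕ → A) : gApprox u n x ≤ 1 := by
  rw [← sum_gApprox hu n (shift x)]
  conv_lhs => rw [← cons_head_shift x]
  exact Finset.single_le_sum (f := fun a => gApprox u n (cons a (shift x)))
    (fun a _ => (gApprox_pos hu n _).le) (Finset.mem_univ _)

/-- The lower bound of the normalized weight of a weight with constants `δ`, `C`, `ρ`. -/
def lowerConst (A : Type*) [Fintype A] (δ K : ℝ) : ℝ :=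
  δ ^ 2 * Real.exp (-K) / Fintype.card A

lemma isWeight_gApprox (hu : IsWeight δ C ρ u) (hK : 2 * C ≤ (1 - ρ) * K) (n : ℕ) :
    IsWeight (lowerConst A δ K) (C + 2 * K) ρ (gApprox u n) := by
  have hcard : (0 : ℝ) < Fintype.card A := by exact_mod_cast Fintype.card_pos
  have hK0 := hu.K_nonneg hK
  have hδ := hu.δ_pos
  have hpos : 0 < lowerConst A δ K := by unfold lowerConst; positivity
  have hlow : ∀ x, lowerConst A δ K ≤ gApprox u n x := fun x => by
    have h1 : ruelle u (n + 1) (fun _ => 1) (shift x) ≤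
        Fintype.card A * (δ⁻¹ * (Real.exp K * ruelle u n (fun _ => 1) x)) := by
      change ∑ a, u _ * ruelle u n (fun _ => 1) _ ≤ _
      calc _ ≤ ∑ a : A, δ⁻¹ * (Real.exp K * ruelle u n (fun _ => 1) x) :=
            Finset.sum_le_sum fun a _ => mul_le_mul (hu.upper _)
              ((inCone_ruelle_one hu hK n).le_all _ _) (ruelle_one_pos hu _ _).le (by positivity)
        _ = _ := by simp
    have hp := ruelle_one_pos hu n x
    rw [gApprox, le_div_iff₀ (ruelle_one_pos hu _ _)]
    calc _ ≤ lowerConst A δ K *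
          (Fintype.card A * (δ⁻¹ * (Real.exp K * ruelle u n (fun _ => 1) x))) := by gcongr
      _ = δ * ruelle u n (fun _ => 1) x := by
          rw [lowerConst, Real.exp_neg]
          field_simp
      _ ≤ _ := by have := hu.lower x; gcongr
  obtain ⟨a₀⟩ := ‹Nonempty A›
  refine ⟨hpos, by linarith [hu.C_nonneg], hu.ρ_pos, hu.ρ_lt, hlow, fun x => ?_, ?_⟩
  · refine (gApprox_le_one hu n x).trans ?_
    rw [one_le_inv₀ hpos]
    exact (hlow x).trans (gApprox_le_one hu n x)
  · intro m x y hxy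
    have h1 := hu.distortion m x y hxy
    have h2 := (inCone_ruelle_one hu hK n).le m x y fun i hi => hxy i hi.le
    have h3 := (inCone_ruelle_one hu hK (n + 1)).le m (shift y) (shift x)
      fun i hi => (hxy (i + 1) hi).symm
    have p1 := ruelle_one_pos hu n x
    have p2 := ruelle_one_pos hu (n + 1) (shift x)
    have p3 := ruelle_one_pos hu (n + 1) (shift y)
    have p4 := ruelle_one_pos hu n y
    have u1 := hu.pos x
    have u2 := hu.pos y
    rw [gApprox, gApprox, ← mul_div_assoc, div_le_div_iff₀ p2 p3]
    calc u x * ruelle u n (fun _ => 1) x * ruelle u (n + 1) (fun _ => 1) (shift y)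
        ≤ (Real.exp (C * ρ ^ m) * u y) * (Real.exp (K * ρ ^ m) * ruelle u n (fun _ => 1) y) *
          (Real.exp (K * ρ ^ m) * ruelle u (n + 1) (fun _ => 1) (shift x)) := by gcongr
      _ = (Real.exp (C * ρ ^ m) * Real.exp (K * ρ ^ m) * Real.exp (K * ρ ^ m)) *
          (u y * ruelle u n (fun _ => 1) y) * ruelle u (n + 1) (fun _ => 1) (shift x) := by ring
      _ = _ := by rw [← Real.exp_add, ← Real.exp_add]; ring_nf

lemma abs_gApprox_add_sub_le (hu : IsWeight δ C ρ u) (hK : 2 * C ≤ (1 - ρ) * K) (n k : ℕ)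
    (x : ℕ → A) :
    |gApprox u (n + k) x - gApprox u n x| ≤ Real.exp (2 * K) * rate K ρ ^ n := by
  -- `gApprox u (n + k) / gApprox u n` is a quotient of two values of `L^m f / L^m 1`, where
  -- `f = L^k 1` and `m` is `n` or `n + 1`
  set f := ruelle u k (fun _ => 1) with hf
  have cf : InCone K ρ f := inCone_ruelle_one hu hK k
  have c1 : InCone K ρ (fun _ : ℕ → A => 1) := inCone_one (hu.K_nonneg hK) hu.ρ_pos.le
  have fpos : ∀ y, 0 < f y := ruelle_one_pos hu k
  set β := Real.exp K * f x with hβ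
  have hβ0 : 0 < β := mul_pos (Real.exp_pos _) (fpos _)
  have hne : ∀ _ : ℕ, (Finset.univ : Finset A).Nonempty := fun _ => Finset.univ_nonempty
  have hq := cf.abs_ratio_sub_le hu hK hne hne (n := n) (fun _ _ => rfl) c1 (fun _ => one_pos)
    (β := β) (fun y => by simpa using cf.le_all y x) le_rfl (Nat.le_succ n) x (shift x)
  have e1 : ruelle u n f = ruelle u (n + k) (fun _ => 1) := ruelle_add u n k _
  have e2 : ruelle u (n + 1) f = ruelle u (n + k + 1) (fun _ => 1) := by
    rw [hf, ruelle_add]; congr 1; ring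
  change |ruelle u n f x / ruelle u n (fun _ => 1) x -
    ruelle u (n + 1) f (shift x) / ruelle u (n + 1) (fun _ => 1) (shift x)| ≤ _ at hq
  have p1 := ruelle_one_pos hu n x
  have p2 := ruelle_one_pos hu (n + 1) (shift x)
  have p3 : 0 < ruelle u (n + k + 1) (fun _ => 1) (shift x) := ruelle_one_pos hu _ _
  have hlow : Real.exp (-2 * K) * β ≤
      ruelle u (n + 1) f (shift x) / ruelle u (n + 1) (fun _ => 1) (shift x) := by
    rw [le_div_iff₀ p2]
    have := iter_mono hu (S := fun _ => Finset.univ) (f := fun _ => Real.exp (-2 * K) * β * 1)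
      (g := f) (fun y => ?_) (n + 1) (shift x)
    · rwa [iter_smul] at this
    · have := cf.le_all x y
      calc Real.exp (-2 * K) * β * 1 ≤ Real.exp (-2 * K) * (Real.exp K * (Real.exp K * f y)) := by
            rw [mul_one, hβ]; gcongr
        _ = (Real.exp (-2 * K) * Real.exp K * Real.exp K) * f y := by ring
        _ = f y := by rw [← Real.exp_add, ← Real.exp_add]; ring_nf; simp
  rw [e2] at hq hlow
  rw [e1] at hq
  set q₁ := ruelle u (n + k) (fun _ => 1) x / ruelle u n (fun _ => 1) x with hq₁
  set q₂ := ruelle u (n + k + 1) (fun _ => 1) (shift x) / ruelle u (n + 1) (fun _ => 1) (shift x)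
    with hq₂
  have hq₂0 : 0 < q₂ := div_pos p3 p2
  have key : gApprox u (n + k) x - gApprox u n x = gApprox u n x * ((q₁ - q₂) / q₂) := by
    rw [gApprox, gApprox, hq₁, hq₂]
    field_simp
  rw [key, abs_mul, abs_div, abs_of_pos hq₂0, abs_of_pos (gApprox_pos hu n x)]
  have h1 : |q₁ - q₂| / q₂ ≤ Real.exp (2 * K) * rate K ρ ^ n := by
    rw [div_le_iff₀ hq₂0]
    have hr := (rate_pos hu.ρ_pos hu.ρ_lt (hu.K_nonneg hK) (K := K)).le
    calc |q₁ - q₂| ≤ rate K ρ ^ n * β := hq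
      _ = Real.exp (2 * K) * rate K ρ ^ n * (Real.exp (-2 * K) * β) := by
          have : Real.exp (2 * K) * Real.exp (-2 * K) = 1 := by rw [← Real.exp_add]; simp
          linear_combination (-(rate K ρ ^ n * β)) * this
      _ ≤ _ := by gcongr
  have h2 : 0 ≤ |q₁ - q₂| / q₂ := by positivity
  have := gApprox_le_one hu n x
  have := (gApprox_pos hu n x).le
  nlinarith

lemma tendsto_gApprox (hu : IsWeight δ C ρ u) (hK : 2 * C ≤ (1 - ρ) * K) (x : ℕ → A) :
    Tendsto (fun n => gApprox u n x) atTop (𝓝 (gfun u x)) := by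
  have : CauchySeq fun n => gApprox u n x := by
    refine cauchySeq_of_le_tendsto_0' (fun n => Real.exp (2 * K) * rate K ρ ^ n)
      (fun n m hnm => ?_) (tendsto_rate_pow hu hK _)
    obtain ⟨k, rfl⟩ := Nat.exists_eq_add_of_le hnm
    rw [dist_comm, Real.dist_eq]
    exact abs_gApprox_add_sub_le hu hK n k x
  exact CauchySeq.tendsto_limUnder this

lemma abs_gfun_sub_le (hu : IsWeight δ C ρ u) (hK : 2 * C ≤ (1 - ρ) * K) (n : ℕ) (x : ℕ → A) :
    |gfun u x - gApprox u n x| ≤ Real.exp (2 * K) * rate K ρ ^ n := by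
  have h := ((tendsto_gApprox hu hK x).sub_const (gApprox u n x)).abs
  refine le_of_tendsto h ?_
  filter_upwards [eventually_ge_atTop n] with m hm
  obtain ⟨k, rfl⟩ := Nat.exists_eq_add_of_le hm
  exact abs_gApprox_add_sub_le hu hK n k x

lemma isWeight_gfun (hu : IsWeight δ C ρ u) (hK : 2 * C ≤ (1 - ρ) * K) :
    IsWeight (lowerConst A δ K) (C + 2 * K) ρ (gfun u) := by
  have h := isWeight_gApprox hu hK
  have ht := tendsto_gApprox hu hK
  exact ⟨(h 0).δ_pos, (h 0).C_nonneg, hu.ρ_pos, hu.ρ_lt,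
    fun x => ge_of_tendsto' (ht x) fun n => (h n).lower x,
    fun x => le_of_tendsto' (ht x) fun n => (h n).upper x,
    fun m x y hxy => le_of_tendsto_of_tendsto' (ht x) ((ht y).const_mul _)
      fun n => (h n).distortion m x y hxy⟩

lemma sum_gfun (hu : IsWeight δ C ρ u) (hK : 2 * C ≤ (1 - ρ) * K) (x : ℕ → A) :
    ∑ a, gfun u (cons a x) = 1 :=
  tendsto_nhds_unique (tendsto_finsetSum _ fun a _ => tendsto_gApprox hu hK (cons a x))
    (by simp only [sum_gApprox hu, tendsto_const_nhds])

lemma prod_gApprox (hu : IsWeight δ C ρ u) (m n : ℕ) (x : ℕ → A) :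
    ∏ k ∈ Finset.range n, gApprox u (m + k) (shift^[k] x) =
      weightProd u n x * ruelle u m (fun _ => 1) x /
        ruelle u (m + n) (fun _ => 1) (shift^[n] x) := by
  induction n with
  | zero =>
    have := (ruelle_one_pos hu m x).ne'
    simp [weightProd, this]
  | succ n ih =>
    have h1 := (ruelle_one_pos hu (m + n) (shift^[n] x)).ne'
    have h2 := (ruelle_one_pos hu (m + n + 1) (shift (shift^[n] x))).ne'
    rw [Finset.prod_range_succ, ih, weightProd, weightProd, Finset.prod_range_succ, gApprox,
      ← add_assoc, Function.iterate_succ_apply']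
    field_simp

/-- A measure with the upper and lower Gibbs bounds for `u` has the upper Gibbs bound, with zero
pressure, for the normalized weight: summing the bounds over words gives `L^n 1 ≍ exp (n P)`, and
the product of `g` along an orbit telescopes. -/
lemma exists_le_weightProd_gfun [TopologicalSpace A] [DiscreteTopology A] [MeasurableSpace A]
    [BorelSpace A] {μ : Measure (ℕ → A)} [IsProbabilityMeasure μ]
    (hu : IsWeight δ C ρ u) (hK : 2 * C ≤ (1 - ρ) * K) {D P : ℝ} (hD : 0 < D)
    (hlow : ∀ n x, D⁻¹ * (weightProd u n x * Real.exp (-(n * P))) ≤ μ.real (PiNat.cylinder x n))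
    (hup : ∀ n x, μ.real (PiNat.cylinder x n) ≤ D * (weightProd u n x * Real.exp (-(n * P))))
    (n : ℕ) (x : ℕ → A) :
    μ.real (PiNat.cylinder x n) ≤ D ^ 3 * weightProd (gfun u) n x := by
  have hL1 : ∀ (n : ℕ) y, ruelle u n (fun _ => 1) y ≤ D * Real.exp (n * P) := fun n y => by
    have h : ∑ w : Fin n → A, D⁻¹ * (weightProd u n (app w y) * Real.exp (-(n * P))) ≤ 1 := by
      rw [← sum_cylinder μ n y]
      exact Finset.sum_le_sum fun w _ => hlow n _
    rw [← Finset.mul_sum, ← Finset.sum_mul, inv_mul_le_iff₀ hD, Real.exp_neg,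
      ← div_eq_mul_inv, div_le_iff₀ (Real.exp_pos _), mul_one] at h
    simpa [ruelle_eq_sum] using h
  have hL2 : ∀ (n : ℕ) y, D⁻¹ * Real.exp (n * P) ≤ ruelle u n (fun _ => 1) y := fun n y => by
    have h : 1 ≤ ∑ w : Fin n → A, D * (weightProd u n (app w y) * Real.exp (-(n * P))) := by
      rw [← sum_cylinder μ n y]
      exact Finset.sum_le_sum fun w _ => hup n _
    rw [← Finset.mul_sum, ← Finset.sum_mul, ← inv_mul_le_iff₀ hD, Real.exp_neg,
      ← div_eq_mul_inv, le_div_iff₀ (Real.exp_pos _), mul_one] at h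
    simpa [ruelle_eq_sum] using h
  have hwp : 0 ≤ weightProd u n x := Finset.prod_nonneg fun k _ => (hu.pos _).le
  have hlim : Tendsto (fun m => ∏ k ∈ Finset.range n, gApprox u (m + k) (shift^[k] x)) atTop
      (𝓝 (weightProd (gfun u) n x)) :=
    tendsto_finsetProd _ fun k _ =>
      (tendsto_gApprox hu hK _).comp (tendsto_add_atTop_nat k)
  have hg : D⁻¹ ^ 2 * (weightProd u n x * Real.exp (-(n * P))) ≤ weightProd (gfun u) n x := by
    refine ge_of_tendsto' hlim fun m => ?_
    rw [prod_gApprox hu, le_div_iff₀ (ruelle_one_pos hu _ _)]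
    have e : Real.exp (-(n * P)) * Real.exp (((m + n : ℕ) : ℝ) * P) = Real.exp (m * P) := by
      rw [← Real.exp_add]; push_cast; ring_nf
    calc _ ≤ D⁻¹ ^ 2 * (weightProd u n x * Real.exp (-(n * P))) *
          (D * Real.exp (((m + n : ℕ) : ℝ) * P)) := by gcongr; exact hL1 _ _
      _ = weightProd u n x *
          (D⁻¹ * (Real.exp (-(n * P)) * Real.exp (((m + n : ℕ) : ℝ) * P))) := by
          field_simp
      _ ≤ _ := by rw [e]; gcongr; exact hL2 _ _
  calc _ ≤ D * (weightProd u n x * Real.exp (-(n * P))) := hup n x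
    _ = D ^ 3 * (D⁻¹ ^ 2 * (weightProd u n x * Real.exp (-(n * P)))) := by field_simp
    _ ≤ _ := by gcongr

end gfun

/-! ### Continuous functions on the full shift -/

section continuity

variable [TopologicalSpace A]

lemma exists_forall_abs_le [Finite A] {F : (ℕ → A) → ℝ} (hF : Continuous F) :
    ∃ m, 0 ≤ m ∧ ∀ x, |F x| ≤ m := by
  obtain ⟨m, hm⟩ := isCompact_univ.exists_bound_of_continuousOn (f := F) hF.continuousOn
  exact ⟨max m 0, le_max_right _ _, fun x => (hm x trivial).trans (le_max_left _ _)⟩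

lemma continuous_cons (a : A) : Continuous (cons a) := by
  refine continuous_pi fun i => ?_
  cases i with
  | zero => exact continuous_const
  | succ i => exact continuous_apply i

lemma continuous_shift : Continuous (shift (A := A)) :=
  continuous_pi fun i => continuous_apply (i + 1)

lemma continuous_transfer {u f : (ℕ → A) → ℝ} (hu : Continuous u) (hf : Continuous f)
    (S : Finset A) : Continuous (transfer u S f) :=
  continuous_finsetSum _ fun a _ =>
    (hu.comp (continuous_cons a)).mul (hf.comp (continuous_cons a))

lemma continuous_iter {u f : (ℕ → A) → ℝ} (hu : Continuous u) (hf : Continuous f)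
    (S : ℕ → Finset A) (n : ℕ) : Continuous (iter u S n f) := by
  induction n with
  | zero => exact hf
  | succ n ih => exact continuous_transfer hu ih _

variable [DiscreteTopology A]

lemma continuous_of_forall_exists {F : (ℕ → A) → ℝ}
    (h : ∀ ε > 0, ∃ n, ∀ x y, (∀ i < n, x i = y i) → |F x - F y| < ε) : Continuous F := by
  refine continuous_iff_continuousAt.2 fun x => Metric.tendsto_nhds.2 fun ε hε => ?_
  obtain ⟨n, hn⟩ := h ε hε
  filter_upwards [(PiNat.isOpen_cylinder _ x n).mem_nhds (PiNat.self_mem_cylinder x n)] with y hy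
  exact hn y x fun i hi => hy i hi

lemma continuous_of_letters {F : (ℕ → A) → ℝ} {n : ℕ}
    (h : ∀ x y, (∀ i < n, x i = y i) → F x = F y) : Continuous F :=
  continuous_of_forall_exists fun ε hε => ⟨n, fun x y hxy => by simpa [h x y hxy] using hε⟩

/-- Uniform continuity on the compact full shift. -/
lemma exists_forall_abs_sub_lt [Finite A] {F : (ℕ → A) → ℝ} (hF : Continuous F) {ε : ℝ}
    (hε : 0 < ε) : ∃ n, ∀ x y, (∀ i < n, x i = y i) → |F x - F y| < ε := by
  have h : ∀ x : ℕ → A, ∃ n, ∀ y ∈ PiNat.cylinder x n, |F y - F x| < ε / 2 := fun x => by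
    have h1 : {y | |F y - F x| < ε / 2} ∈ 𝓝 x :=
      (isOpen_lt (by fun_prop) continuous_const).mem_nhds (by simpa using hε)
    obtain ⟨_, ⟨z, n, rfl⟩, hx, hsub⟩ :=
      (PiNat.isTopologicalBasis_cylinders (fun _ : ℕ => A)).mem_nhds_iff.1 h1
    refine ⟨n, fun y hy => hsub ?_⟩
    rwa [← PiNat.mem_cylinder_iff_eq.1 hx]
  choose n hn using h
  obtain ⟨t, -, ht⟩ := isCompact_univ.elim_nhds_subcover (fun x => PiNat.cylinder x (n x))
    fun x _ => (PiNat.isOpen_cylinder _ x (n x)).mem_nhds (PiNat.self_mem_cylinder x _)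
  refine ⟨t.sup n, fun x y hxy => ?_⟩
  obtain ⟨z, hz, hxz⟩ := Set.mem_iUnion₂.1 (ht (Set.mem_univ x))
  have hyz : y ∈ PiNat.cylinder z (n z) := fun i hi => by
    rw [← hxy i (hi.trans_le (Finset.le_sup hz)), hxz i hi]
  have h1 := hn z x hxz
  have h2 := hn z y hyz
  rw [abs_lt] at *
  constructor <;> linarith [h1.1, h1.2, h2.1, h2.2]

lemma IsWeight.continuous {δ C ρ : ℝ} {u : (ℕ → A) → ℝ} (hu : IsWeight δ C ρ u) :
    Continuous u := by
  refine continuous_of_forall_exists fun ε hε => ?_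
  have h0 : Tendsto (fun n : ℕ => (Real.exp (C * ρ ^ n) - 1) * δ⁻¹) atTop (𝓝 0) := by
    have h1 := (tendsto_pow_atTop_nhds_zero_of_lt_one hu.ρ_pos.le hu.ρ_lt).const_mul C
    have h2 := (((Real.continuous_exp.tendsto _).comp h1).sub_const 1).mul_const δ⁻¹
    simpa using h2
  obtain ⟨n, hn⟩ := (h0.eventually (gt_mem_nhds hε)).exists
  have key : ∀ x y, (∀ i ≤ n, x i = y i) → u x - u y < ε := fun x y hxy => by
    have h1 := hu.distortion n x y hxy
    have h2 : 1 ≤ Real.exp (C * ρ ^ n) :=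
      Real.one_le_exp (mul_nonneg hu.C_nonneg (pow_nonneg hu.ρ_pos.le _))
    nlinarith [hu.upper y]
  refine ⟨n + 1, fun x y hxy => abs_lt.2 ?_⟩
  have h1 := key x y fun i hi => hxy i (by omega)
  have h2 := key y x fun i hi => (hxy i (by omega)).symm
  constructor <;> linarith

variable [Finite A] [MeasurableSpace A] [BorelSpace A]

lemma integrable_of_continuous (μ : Measure (ℕ → A)) [IsProbabilityMeasure μ]
    {F : (ℕ → A) → ℝ} (hF : Continuous F) : Integrable F μ :=
  hF.integrable_of_hasCompactSupport (HasCompactSupport.of_compactSpace F)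

lemma integral_comp_shift {μ : Measure (ℕ → A)} (hμ : MeasurePreserving shift μ μ)
    {F : (ℕ → A) → ℝ} (hF : Continuous F) : ∫ x, F (shift x) ∂μ = ∫ x, F x ∂μ := by
  conv_rhs => rw [← hμ.map_eq]
  exact (integral_map hμ.measurable.aemeasurable hF.aestronglyMeasurable).symm

lemma sq_integral_le {μ : Measure (ℕ → A)} [IsProbabilityMeasure μ] {F : (ℕ → A) → ℝ}
    (hF : Continuous F) : (∫ x, F x ∂μ) ^ 2 ≤ ∫ x, F x ^ 2 ∂μ := by
  set c := ∫ x, F x ∂μ with hc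
  have h : 0 ≤ ∫ x, (F x ^ 2 - 2 * c * F x + c ^ 2) ∂μ :=
    integral_nonneg fun x => by
      change 0 ≤ F x ^ 2 - 2 * c * F x + c ^ 2
      nlinarith [sq_nonneg (F x - c)]
  rw [integral_add ((integrable_of_continuous μ (by fun_prop))) (integrable_const _),
    integral_sub (integrable_of_continuous μ (by fun_prop))
      (integrable_of_continuous μ (by fun_prop)), integral_const_mul, ← hc] at h
  simp at h
  nlinarith

end continuity

/-! ### Invariant measures with the upper Gibbs bound are fixed by the normalized operator -/

section uniqueness

variable [Fintype A] {δ C ρ : ℝ} {g : (ℕ → A) → ℝ}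

lemma ruelle_const (hg1 : ∀ x, ∑ a, g (cons a x) = 1) (n : ℕ) (c : ℝ) :
    ruelle g n (fun _ => c) = fun _ => c := by
  induction n with
  | zero => rfl
  | succ n ih =>
    change transfer g _ (ruelle g n _) = _
    rw [ih]
    funext x
    simp only [transfer, ← Finset.sum_mul, hg1, one_mul]

lemma abs_ruelle_le (hg : IsWeight δ C ρ g) (hg1 : ∀ x, ∑ a, g (cons a x) = 1) (n : ℕ)
    {F : (ℕ → A) → ℝ} {m : ℝ} (hF : ∀ x, |F x| ≤ m) (x : ℕ → A) : |ruelle g n F x| ≤ m := by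
  rw [abs_le]
  constructor
  · have := iter_mono hg (S := fun _ => Finset.univ) (f := fun _ => -m)
      (fun x => (abs_le.1 (hF x)).1) n x
    rwa [show iter g (fun _ => Finset.univ) n (fun _ => -m) = fun _ => -m from
      ruelle_const hg1 n _] at this
  · have := iter_mono hg (S := fun _ => Finset.univ) (g := fun _ => m)
      (fun x => (abs_le.1 (hF x)).2) n x
    rwa [show iter g (fun _ => Finset.univ) n (fun _ => m) = fun _ => m from
      ruelle_const hg1 n _] at this

lemma ruelle_comp_shift_succ (hg1 : ∀ x, ∑ a, g (cons a x) = 1) (n : ℕ) (F : (ℕ → A) → ℝ) :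
    ruelle g (n + 1) (fun x => F (shift x)) = ruelle g n F := by
  rw [← ruelle_add]
  congr 1
  have := ruelle_comp_shift g F (fun _ => 1) 1
  rw [ruelle_const hg1] at this
  simpa using this

lemma ruelle_sum (n N : ℕ) (f : ℕ → (ℕ → A) → ℝ) (x : ℕ → A) :
    ruelle g n (fun y => ∑ k ∈ Finset.range N, f k y) x =
      ∑ k ∈ Finset.range N, ruelle g n (f k) x := by
  simp only [ruelle_eq_sum, Finset.mul_sum]
  exact Finset.sum_comm

/-- If `L^n F` decays exponentially, then `L^M ((S_N F)^2)` grows at most linearly in `N`. -/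
lemma ruelle_birkhoffSum_sq_le (hg : IsWeight δ C ρ g) (hg1 : ∀ x, ∑ a, g (cons a x) = 1)
    {F : (ℕ → A) → ℝ} {m E κ : ℝ} (hE : 0 ≤ E) (hκ0 : 0 < κ) (hκ : κ < 1)
    (hF : ∀ x, |F x| ≤ m) (hdecay : ∀ n x, |ruelle g n F x| ≤ E * κ ^ n) (N M : ℕ) (hNM : N ≤ M)
    (x : ℕ → A) :
    ruelle g M (fun y => birkhoffSum shift F N y ^ 2) x ≤
      (m ^ 2 + 2 * (m * (E * (1 - κ)⁻¹))) * N := by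
  induction N generalizing M x with
  | zero =>
    have : ruelle g M (fun _ => 0) x = 0 := by rw [ruelle_const hg1]
    simp [this]
  | succ N ih =>
    obtain ⟨M, rfl⟩ : ∃ M', M = M' + 1 := ⟨M - 1, by omega⟩
    have hm : 0 ≤ m := (abs_nonneg _).trans (hF x)
    have e : (fun y => birkhoffSum shift F (N + 1) y ^ 2) = fun y =>
        (F y ^ 2 + 2 * ∑ k ∈ Finset.range N, F y * F (shift^[k + 1] y)) +
          birkhoffSum shift F N (shift y) ^ 2 := by
      funext y
      rw [birkhoffSum_succ', ← Finset.mul_sum]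
      simp only [birkhoffSum, Function.iterate_succ_apply]
      ring
    have h1 : ruelle g (M + 1) (fun y => F y ^ 2) x ≤ m ^ 2 := by
      refine (le_abs_self _).trans (abs_ruelle_le hg hg1 _ (fun y => ?_) x)
      rw [abs_pow]
      exact pow_le_pow_left₀ (abs_nonneg _) (hF y) 2
    have h2 : ∀ k ∈ Finset.range N, ruelle g (M + 1) (fun y => F y * F (shift^[k + 1] y)) x ≤
        m * (E * κ ^ k) := fun k hk => by
      rw [Finset.mem_range] at hk
      obtain ⟨j, hj⟩ : ∃ j, M + 1 = j + (k + 1) := ⟨M - k, by omega⟩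
      rw [hj, ← ruelle_add, ruelle_comp_shift]
      refine (le_abs_self _).trans (abs_ruelle_le hg hg1 _ (fun y => ?_) x)
      rw [abs_mul]
      have h3 := hdecay (k + 1) y
      have h4 : E * κ ^ (k + 1) ≤ E * κ ^ k :=
        mul_le_mul_of_nonneg_left (pow_le_pow_of_le_one hκ0.le hκ.le (Nat.le_succ k)) hE
      exact mul_le_mul (hF y) (h3.trans h4) (abs_nonneg _) hm
    have h3 : ∑ k ∈ Finset.range N, ruelle g (M + 1) (fun y => F y * F (shift^[k + 1] y)) x ≤
        m * (E * (1 - κ)⁻¹) := by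
      refine (Finset.sum_le_sum h2).trans ?_
      rw [← Finset.mul_sum, ← Finset.mul_sum]
      have h5 : ∑ k ∈ Finset.range N, κ ^ k ≤ (1 - κ)⁻¹ := by
        rw [← tsum_geometric_of_lt_one hκ0.le hκ]
        exact (summable_geometric_of_lt_one hκ0.le hκ).sum_le_tsum _
          fun k _ => pow_nonneg hκ0.le k
      gcongr
    have h4 := ih M (by omega) x
    have h5 : ruelle g (M + 1) (fun y => birkhoffSum shift F (N + 1) y ^ 2) x =
        ruelle g (M + 1) (fun y => F y ^ 2) x +
        2 * (∑ k ∈ Finset.range N, ruelle g (M + 1) (fun y => F y * F (shift^[k + 1] y)) x) +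
        ruelle g M (fun y => birkhoffSum shift F N y ^ 2) x := by
      rw [e, ← ruelle_comp_shift_succ hg1 M, ← ruelle_sum]
      simp only [ruelle, iter_add, iter_smul]
    rw [h5]
    push_cast
    linarith

/-- For functions of finitely many letters, the powers of the normalized operator converge
exponentially fast to a constant. -/
lemma exists_ruelle_decay [Nonempty A] (hg : IsWeight δ C ρ g)
    (hg1 : ∀ x, ∑ a, g (cons a x) = 1)
    {F : (ℕ → A) → ℝ} {k : ℕ} (hF : ∀ x y, (∀ i < k, x i = y i) → F x = F y)
    {m : ℝ} (hm : ∀ x, |F x| ≤ m) :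
    ∃ c E κ : ℝ, 0 ≤ E ∧ 0 < κ ∧ κ < 1 ∧ ∀ n x, |ruelle g n F x - c| ≤ E * κ ^ n := by
  obtain ⟨a₀⟩ := ‹Nonempty A›
  set x₀ : ℕ → A := fun _ => a₀
  have hm0 : 0 ≤ m := (abs_nonneg _).trans (hm x₀)
  have hρ0 := hg.ρ_pos
  have hρ1 : 0 < 1 - ρ := by linarith [hg.ρ_lt]
  -- a constant `K` for which `F + m + 1` is in the cone
  set K := 2 * C / (1 - ρ) + (2 * m + 1) / ρ ^ k with hKdef
  have hC := hg.C_nonneg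
  have hK : 2 * C ≤ (1 - ρ) * K := by
    have : 0 ≤ (1 - ρ) * ((2 * m + 1) / ρ ^ k) := by positivity
    rw [hKdef, mul_add, mul_div_cancel₀ _ hρ1.ne']
    linarith
  have hK' : ∀ n < k, 2 * m + 1 ≤ K * ρ ^ n := fun n hn => by
    have h1 : ρ ^ k ≤ ρ ^ n := pow_le_pow_of_le_one hρ0.le hg.ρ_lt.le hn.le
    have h2 : (2 * m + 1) / ρ ^ k ≤ K := by
      have : 0 ≤ 2 * C / (1 - ρ) := by positivity
      linarith
    calc 2 * m + 1 = (2 * m + 1) / ρ ^ k * ρ ^ k := by field_simp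
      _ ≤ K * ρ ^ n := by gcongr
  have hK0 := hg.K_nonneg hK
  have cone : InCone K ρ (fun x => F x + (m + 1)) := by
    refine ⟨fun x => by linarith [(abs_le.1 (hm x)).1], fun n x y hxy => ?_⟩
    have hy := (abs_le.1 (hm y)).1
    rcases lt_or_ge n k with hn | hn
    · have h1 := (abs_le.1 (hm x)).2
      have h2 := Real.add_one_le_exp (K * ρ ^ n)
      have h3 := hK' n hn
      nlinarith
    · rw [hF x y fun i hi => hxy i (hi.trans_le hn)]
      exact le_mul_of_one_le_left (by linarith) (Real.one_le_exp (by positivity))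
  set κ := rate K ρ with hκ
  have hcone := fun n n' (hnn : n ≤ n') x y => cone.abs_ratio_sub_le hg hK (n := n)
    (S := fun _ => Finset.univ) (S' := fun _ => Finset.univ)
    (fun _ => ⟨a₀, Finset.mem_univ _⟩) (fun _ => ⟨a₀, Finset.mem_univ _⟩) (fun _ _ => rfl)
    (inCone_one hK0 hρ0.le) (fun _ => one_pos) (β := 2 * m + 1)
    (fun x => by linarith [(abs_le.1 (hm x)).2]) le_rfl hnn x y
  have hone : ∀ n, iter g (fun _ => Finset.univ) n (fun _ => (1 : ℝ)) = fun _ => 1 :=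
    fun n => ruelle_const hg1 n 1
  have hcst : ∀ n, iter g (fun _ => Finset.univ) n (fun _ => m + 1) = fun _ => m + 1 :=
    fun n => ruelle_const hg1 n (m + 1)
  simp only [iter_add, hone, hcst, div_one, add_sub_add_right_eq_sub] at hcone
  have hcau : CauchySeq fun n => ruelle g n F x₀ := by
    refine cauchySeq_of_le_tendsto_0' (fun n => (2 * m + 1) * κ ^ n) (fun n n' hnn => ?_)
      (tendsto_rate_pow hg hK _)
    rw [Real.dist_eq, mul_comm]
    exact hcone n n' hnn x₀ x₀
  obtain ⟨c, hc⟩ := cauchySeq_tendsto_of_complete hcau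
  refine ⟨c, 2 * m + 1, κ, by linarith, rate_pos hρ0 hg.ρ_lt hK0, rate_lt_one hρ0 hg.ρ_lt,
    fun n x => ?_⟩
  refine le_of_tendsto ((hc.const_sub (ruelle g n F x)).abs) ?_
  filter_upwards [eventually_ge_atTop n] with n' hn'
  rw [mul_comm]
  exact hcone n n' hn' x x₀

variable [TopologicalSpace A] [DiscreteTopology A] [MeasurableSpace A] [BorelSpace A]
  {μ : Measure (ℕ → A)} [IsProbabilityMeasure μ] {D : ℝ}

lemma integral_le_ruelle
    (hD : ∀ n x, μ.real (PiNat.cylinder x n) ≤ D * weightProd g n x) {F : (ℕ → A) → ℝ} {n : ℕ}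
    (hF : ∀ x y, (∀ i < n, x i = y i) → F x = F y) (hF0 : ∀ x, 0 ≤ F x) (x : ℕ → A) :
    ∫ y, F y ∂μ ≤ D * ruelle g n F x := by
  rw [integral_eq_sum μ n x hF, ruelle_eq_sum, Finset.mul_sum]
  refine Finset.sum_le_sum fun w _ => ?_
  have := mul_le_mul_of_nonneg_left (hD n (app w x)) (hF0 (app w x))
  linarith

lemma integral_birkhoffSum (hμ : MeasurePreserving shift μ μ) {F : (ℕ → A) → ℝ}
    (hF : Continuous F) (N : ℕ) : ∫ x, birkhoffSum shift F N x ∂μ = N * ∫ x, F x ∂μ := by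
  have hN : ∀ N, Continuous (birkhoffSum shift F N) := fun N =>
    continuous_finsetSum _ fun k _ => hF.comp (continuous_shift.iterate k)
  induction N with
  | zero => simp
  | succ N ih =>
    simp only [birkhoffSum_succ']
    rw [integral_add (integrable_of_continuous μ hF)
      (integrable_of_continuous μ (F := fun x => birkhoffSum shift F N (shift x))
        ((hN N).comp continuous_shift)),
      integral_comp_shift hμ (hN N), ih]
    push_cast
    ring

/-- An exponentially decaying function of finitely many letters has integral zero: by invariance
`N ∫ F = ∫ S_N F`, while `∫ (S_N F)^2` is at most linear in `N`. -/
lemma integral_eq_zero_of_decay [Nonempty A] (hg : IsWeight δ C ρ g)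
    (hg1 : ∀ x, ∑ a, g (cons a x) = 1) (hμ : MeasurePreserving shift μ μ) (hD0 : 0 ≤ D)
    (hD : ∀ n x, μ.real (PiNat.cylinder x n) ≤ D * weightProd g n x) {F : (ℕ → A) → ℝ} {k : ℕ}
    (hF : ∀ x y, (∀ i < k, x i = y i) → F x = F y) {m E κ : ℝ} (hm : ∀ x, |F x| ≤ m)
    (hE : 0 ≤ E) (hκ0 : 0 < κ) (hκ : κ < 1) (hdecay : ∀ n x, |ruelle g n F x| ≤ E * κ ^ n) :
    ∫ x, F x ∂μ = 0 := by
  obtain ⟨a₀⟩ := ‹Nonempty A›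
  have hFc : Continuous F := continuous_of_letters hF
  set V := D * (m ^ 2 + 2 * (m * (E * (1 - κ)⁻¹)))
  have key : ∀ N : ℕ, (N * ∫ x, F x ∂μ) ^ 2 ≤ V * N := fun N => by
    have hc : Continuous (birkhoffSum shift F N) :=
      continuous_finsetSum _ fun k _ => hFc.comp (continuous_shift.iterate k)
    have hdep : ∀ x y : ℕ → A, (∀ i < N + k, x i = y i) →
        birkhoffSum shift F N x ^ 2 = birkhoffSum shift F N y ^ 2 := fun x y hxy => by
      congr 1
      refine Finset.sum_congr rfl fun j hj => hF _ _ fun i hi => ?_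
      rw [Finset.mem_range] at hj
      rw [shift_iterate_apply, shift_iterate_apply]
      exact hxy _ (by omega)
    rw [← integral_birkhoffSum hμ hFc]
    refine (sq_integral_le hc).trans ?_
    refine (integral_le_ruelle hD hdep (fun _ => sq_nonneg _) (fun _ => a₀)).trans ?_
    rw [mul_assoc]
    exact mul_le_mul_of_nonneg_left
      (ruelle_birkhoffSum_sq_le hg hg1 hE hκ0 hκ hm hdecay N (N + k) (by omega) _) hD0
  by_contra hI
  set I := ∫ x, F x ∂μ
  have hI2 : 0 < I ^ 2 := by positivity
  obtain ⟨N, hN⟩ := exists_nat_gt (max (V / I ^ 2) 0)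
  have hN0 : (0 : ℝ) < N := (le_max_right _ _).trans_lt hN
  have h1 : V / I ^ 2 < N := (le_max_left _ _).trans_lt hN
  rw [div_lt_iff₀ hI2] at h1
  have := key N
  nlinarith

lemma tendsto_ruelle_of_letters [Nonempty A] (hg : IsWeight δ C ρ g)
    (hg1 : ∀ x, ∑ a, g (cons a x) = 1) (hμ : MeasurePreserving shift μ μ) (hD0 : 0 ≤ D)
    (hD : ∀ n x, μ.real (PiNat.cylinder x n) ≤ D * weightProd g n x) {F : (ℕ → A) → ℝ} {k : ℕ}
    (hF : ∀ x y, (∀ i < k, x i = y i) → F x = F y) (x : ℕ → A) :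
    Tendsto (fun n => ruelle g n F x) atTop (𝓝 (∫ y, F y ∂μ)) := by
  have hFc : Continuous F := continuous_of_letters hF
  obtain ⟨m, -, hm⟩ := exists_forall_abs_le hFc
  obtain ⟨c, E, κ, hE, hκ0, hκ, hdecay⟩ := exists_ruelle_decay hg hg1 hF hm
  have hsub : ∀ n, ruelle g n (fun y => F y - c) = fun y => ruelle g n F y - c := fun n => by
    change iter g _ n _ = _
    rw [iter_sub]
    change (fun y => ruelle g n F y - ruelle g n (fun _ => c) y) = _
    rw [ruelle_const hg1]
  have h0 : ∫ y, (F y - c) ∂μ = 0 :=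
    integral_eq_zero_of_decay hg hg1 hμ hD0 hD (F := fun y => F y - c)
      (fun x y hxy => by rw [hF x y hxy]) (m := m + |c|)
      (fun x => (abs_sub _ _).trans (by linarith [hm x])) hE hκ0 hκ
      (fun n x => by rw [hsub]; exact hdecay n x)
  rw [integral_sub (integrable_of_continuous μ hFc) (integrable_const _)] at h0
  have hc : ∫ y, F y ∂μ = c := by simpa [sub_eq_zero] using h0
  rw [hc, tendsto_iff_norm_sub_tendsto_zero]
  refine squeeze_zero (fun _ => norm_nonneg _) (fun n => hdecay n x) ?_
  simpa using (tendsto_pow_atTop_nhds_zero_of_lt_one hκ0.le hκ).const_mul E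

/-- The powers of the normalized operator converge to the integral. -/
lemma tendsto_ruelle [Nonempty A] (hg : IsWeight δ C ρ g)
    (hg1 : ∀ x, ∑ a, g (cons a x) = 1) (hμ : MeasurePreserving shift μ μ) (hD0 : 0 ≤ D)
    (hD : ∀ n x, μ.real (PiNat.cylinder x n) ≤ D * weightProd g n x) {F : (ℕ → A) → ℝ}
    (hF : Continuous F) (x : ℕ → A) :
    Tendsto (fun n => ruelle g n F x) atTop (𝓝 (∫ y, F y ∂μ)) := by
  refine Metric.tendsto_atTop.2 fun ε hε => ?_
  obtain ⟨k, hk⟩ := exists_forall_abs_sub_lt hF (show 0 < ε / 4 by positivity)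
  set G : (ℕ → A) → ℝ := fun y => F (app (fun i : Fin k => y i) x) with hG
  have hGF : ∀ y, |F y - G y| ≤ ε / 4 := fun y =>
    (hk _ _ fun i hi => by rw [app_of_lt _ _ hi]).le
  have hGk : ∀ y z, (∀ i < k, y i = z i) → G y = G z := fun y z hyz => by
    simp only [hG]
    congr 2
    funext i
    exact hyz i i.2
  have hGc : Continuous G := continuous_of_letters hGk
  obtain ⟨N, hN⟩ := Metric.tendsto_atTop.1
    (tendsto_ruelle_of_letters hg hg1 hμ hD0 hD hGk x) (ε / 4) (by positivity)
  refine ⟨N, fun n hn => ?_⟩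
  have h1 := hN n hn
  have h2 : |ruelle g n F x - ruelle g n G x| ≤ ε / 4 := by
    have := abs_ruelle_le hg hg1 n hGF x
    rwa [ruelle, iter_sub] at this
  have h3 : |∫ y, F y ∂μ - ∫ y, G y ∂μ| ≤ ε / 4 := by
    rw [← integral_sub (integrable_of_continuous μ hF) (integrable_of_continuous μ hGc)]
    have := norm_integral_le_of_norm_le_const (μ := μ) (f := fun y => F y - G y) (C := ε / 4)
      (Eventually.of_forall hGF)
    simpa using this
  rw [Real.dist_eq] at h1 ⊢
  rw [abs_lt] at h1 ⊢
  rw [abs_le] at h2 h3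
  constructor <;> linarith [h1.1, h1.2, h2.1, h2.2, h3.1, h3.2]

/-- `μ` is a `g`-measure: it is fixed by the dual of the normalized operator. -/
theorem integral_transfer [Nonempty A] (hg : IsWeight δ C ρ g)
    (hg1 : ∀ x, ∑ a, g (cons a x) = 1) (hμ : MeasurePreserving shift μ μ) (hD0 : 0 ≤ D)
    (hD : ∀ n x, μ.real (PiNat.cylinder x n) ≤ D * weightProd g n x) {F : (ℕ → A) → ℝ}
    (hF : Continuous F) : ∫ x, transfer g Finset.univ F x ∂μ = ∫ x, F x ∂μ := by
  obtain ⟨a₀⟩ := ‹Nonempty A›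
  have h1 := tendsto_ruelle hg hg1 hμ hD0 hD
    (continuous_transfer hg.continuous hF Finset.univ) (fun _ => a₀)
  have h2 := (tendsto_ruelle hg hg1 hμ hD0 hD hF (fun _ => a₀)).comp (tendsto_add_atTop_nat 1)
  refine tendsto_nhds_unique h1 (h2.congr fun n => ?_)
  rw [Function.comp_apply, ← ruelle_add]
  rfl

end uniqueness

/-! ### The limiting conditional weight of the amalgamated measure -/

section ratio

lemma le_transfer_one {δ C ρ : ℝ} {g : (ℕ → A) → ℝ} (hg : IsWeight δ C ρ g) {S : Finset A}
    (hS : S.Nonempty) (x : ℕ → A) : δ ≤ transfer g S (fun _ => 1) x := by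
  obtain ⟨a, ha⟩ := hS
  simp only [transfer, mul_one]
  exact (hg.lower (cons a x)).trans
    (Finset.single_le_sum (f := fun a => g (cons a x)) (fun a _ => (hg.pos _).le) ha)

variable [Fintype A] {δ C ρ K : ℝ} {g : (ℕ → A) → ℝ} {π : A → B}

/-- The letters of `A` that `π` sends to `b`. -/
def fiber (π : A → B) (b : B) : Finset A := by
  classical exact Finset.univ.filter fun a => π a = b

lemma mem_fiber {a : A} {b : B} : a ∈ fiber π b ↔ π a = b := by simp [fiber]

lemma fiber_nonempty (hπ : Function.Surjective π) (b : B) : (fiber π b).Nonempty :=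
  (hπ b).imp fun _ h => mem_fiber.2 h

/-- `L_{b_n} ⋯ L_{b_0} 1 / L_{b_n} ⋯ L_{b_1} 1`, where `L_b` is the transfer operator restricted to
the fiber of the letter `b`. -/
def ratioApprox (g : (ℕ → A) → ℝ) (π : A → B) (n : ℕ) (b : ℕ → B) (x : ℕ → A) : ℝ :=
  iter g (fun k => fiber π (b k)) (n + 1) (fun _ => 1) x /
    iter g (fun k => fiber π (shift b k)) n (fun _ => 1) x

/-- The limit of `ratioApprox` as `n → ∞`. It does not depend on the point of `A^ℕ` at which the
quotient is evaluated, so a constant sequence is used. -/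
def ratioLim [Nonempty A] (g : (ℕ → A) → ℝ) (π : A → B) (b : ℕ → B) : ℝ :=
  limUnder atTop fun n => ratioApprox g π n b fun _ => Classical.arbitrary A

lemma iter_fiber_succ (n : ℕ) (b : ℕ → B) (f : (ℕ → A) → ℝ) :
    iter g (fun k => fiber π (b k)) (n + 1) f =
      iter g (fun k => fiber π (shift b k)) n (transfer g (fiber π (b 0)) f) :=
  iter_succ' g _ n f

lemma transfer_one_le (hg : IsWeight δ C ρ g) (hg1 : ∀ x, ∑ a, g (cons a x) = 1) (S : Finset A)
    (x : ℕ → A) : transfer g S (fun _ => 1) x ≤ 1 := by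
  have := Finset.sum_le_sum_of_subset_of_nonneg (f := fun a => g (cons a x)) (Finset.subset_univ S)
    fun a _ _ => (hg.pos _).le
  simpa [transfer, hg1] using this

lemma abs_ratioApprox_sub_le (hg : IsWeight δ C ρ g) (hg1 : ∀ x, ∑ a, g (cons a x) = 1)
    (hK : 2 * C ≤ (1 - ρ) * K) (hπ : Function.Surjective π) {n m m' : ℕ} {b b' : ℕ → B}
    (hb : ∀ i ≤ n, b i = b' i) (hm : n ≤ m) (hm' : n ≤ m') (x y : ℕ → A) :
    |ratioApprox g π m b x - ratioApprox g π m' b' y| ≤ rate K ρ ^ n := by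
  have c1 : InCone K ρ (fun _ : ℕ → A => 1) := inCone_one (hg.K_nonneg hK) hg.ρ_pos.le
  have := (c1.transfer' hg hK (fiber π (b 0))).abs_ratio_sub_le hg hK
    (S := fun k => fiber π (shift b k)) (S' := fun k => fiber π (shift b' k))
    (fun n => fiber_nonempty hπ _) (fun n => fiber_nonempty hπ _)
    (fun i hi => by simp only [shift]; rw [hb (i + 1) hi]) c1 (fun _ => one_pos) (β := 1)
    (fun x => by simpa using transfer_one_le hg hg1 _ x) hm hm' x y
  rw [ratioApprox, ratioApprox, iter_fiber_succ, iter_fiber_succ, ← hb 0 (Nat.zero_le n)]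
  simpa using this

lemma iter_fiber_pos (hg : IsWeight δ C ρ g) (hπ : Function.Surjective π) (n : ℕ) (b : ℕ → B)
    (x : ℕ → A) : 0 < iter g (fun k => fiber π (b k)) n (fun _ => 1) x :=
  iter_pos hg (fun n => fiber_nonempty hπ (b n)) (fun _ => one_pos) n x

lemma mul_iter_fiber_le (hg : IsWeight δ C ρ g) (hπ : Function.Surjective π) (n : ℕ)
    (b : ℕ → B) (x : ℕ → A) :
    δ * iter g (fun k => fiber π (shift b k)) n (fun _ => 1) x ≤
      iter g (fun k => fiber π (b k)) (n + 1) (fun _ => 1) x := by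
  have := iter_mono hg (S := fun k => fiber π (shift b k)) (f := fun _ => δ * 1)
    (fun x => by simpa using le_transfer_one hg (fiber_nonempty hπ (b 0)) x) n x
  rwa [iter_smul, ← iter_fiber_succ] at this

lemma le_ratioApprox (hg : IsWeight δ C ρ g) (hπ : Function.Surjective π) (n : ℕ) (b : ℕ → B)
    (x : ℕ → A) : δ ≤ ratioApprox g π n b x := by
  rw [ratioApprox, le_div_iff₀ (iter_fiber_pos hg hπ n (shift b) x)]
  exact mul_iter_fiber_le hg hπ n b x

variable [Nonempty A]

lemma tendsto_ratioApprox (hg : IsWeight δ C ρ g) (hg1 : ∀ x, ∑ a, g (cons a x) = 1)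
    (hK : 2 * C ≤ (1 - ρ) * K) (hπ : Function.Surjective π) (b : ℕ → B) :
    Tendsto (fun n => ratioApprox g π n b fun _ => Classical.arbitrary A) atTop
      (𝓝 (ratioLim g π b)) := by
  refine CauchySeq.tendsto_limUnder (cauchySeq_of_le_tendsto_0' (fun n => 1 * rate K ρ ^ n)
    (fun n m hnm => ?_) (tendsto_rate_pow hg hK 1))
  rw [Real.dist_eq, one_mul]
  exact abs_ratioApprox_sub_le hg hg1 hK hπ (fun _ _ => rfl) le_rfl hnm _ _

lemma abs_ratioLim_sub_ratioApprox_le (hg : IsWeight δ C ρ g)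
    (hg1 : ∀ x, ∑ a, g (cons a x) = 1) (hK : 2 * C ≤ (1 - ρ) * K) (hπ : Function.Surjective π)
    (n : ℕ) (b : ℕ → B) (x : ℕ → A) :
    |ratioLim g π b - ratioApprox g π n b x| ≤ rate K ρ ^ n := by
  refine le_of_tendsto ((tendsto_ratioApprox hg hg1 hK hπ b).sub_const _).abs ?_
  filter_upwards [eventually_ge_atTop n] with m hm
  exact abs_ratioApprox_sub_le hg hg1 hK hπ (fun _ _ => rfl) hm le_rfl _ _

lemma abs_ratioLim_sub_le (hg : IsWeight δ C ρ g) (hg1 : ∀ x, ∑ a, g (cons a x) = 1)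
    (hK : 2 * C ≤ (1 - ρ) * K) (hπ : Function.Surjective π) {n : ℕ} {b b' : ℕ → B}
    (hb : ∀ i ≤ n, b i = b' i) : |ratioLim g π b - ratioLim g π b'| ≤ rate K ρ ^ n := by
  refine le_of_tendsto ((tendsto_ratioApprox hg hg1 hK hπ b).sub
    (tendsto_ratioApprox hg hg1 hK hπ b')).abs ?_
  filter_upwards [eventually_ge_atTop n] with m hm
  exact abs_ratioApprox_sub_le hg hg1 hK hπ hb hm hm _ _

lemma le_ratioLim (hg : IsWeight δ C ρ g) (hg1 : ∀ x, ∑ a, g (cons a x) = 1)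
    (hK : 2 * C ≤ (1 - ρ) * K) (hπ : Function.Surjective π) (b : ℕ → B) :
    δ ≤ ratioLim g π b :=
  ge_of_tendsto' (tendsto_ratioApprox hg hg1 hK hπ b) fun n => le_ratioApprox hg hπ n b _

lemma abs_log_sub_log_le (hδ : 0 < δ) {s t : ℝ} (hs : δ ≤ s) (ht : δ ≤ t) :
    |Real.log s - Real.log t| ≤ |s - t| / δ := by
  have key : ∀ s t : ℝ, δ ≤ s → δ ≤ t → Real.log s - Real.log t ≤ |s - t| / δ := by
    intro s t hs ht
    have hs0 := hδ.trans_le hs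
    have ht0 := hδ.trans_le ht
    rw [← Real.log_div hs0.ne' ht0.ne']
    calc Real.log (s / t) ≤ s / t - 1 := Real.log_le_sub_one_of_pos (by positivity)
      _ = (s - t) / t := by field_simp
      _ ≤ |s - t| / t := by gcongr; exact le_abs_self _
      _ ≤ |s - t| / δ := by gcongr
  rw [abs_le]
  have h1 := key s t hs ht
  have h2 := key t s ht hs
  rw [abs_sub_comm] at h2
  constructor <;> linarith

/-- The potential of the amalgamated measure, for a normalized weight `g` on `A^ℕ`. -/
def amalgPotential (g : (ℕ → A) → ℝ) (π : A → B) (b : ℕ → B) : ℝ := Real.log (ratioLim g π b)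

lemma abs_amalgPotential_sub_le (hg : IsWeight δ C ρ g) (hg1 : ∀ x, ∑ a, g (cons a x) = 1)
    (hK : 2 * C ≤ (1 - ρ) * K) (hπ : Function.Surjective π) {n : ℕ} {b b' : ℕ → B}
    (hb : ∀ i ≤ n, b i = b' i) :
    |amalgPotential g π b - amalgPotential g π b'| ≤ δ⁻¹ * rate K ρ ^ n := by
  have hδ := hg.δ_pos
  refine (abs_log_sub_log_le hδ (le_ratioLim hg hg1 hK hπ b)
    (le_ratioLim hg hg1 hK hπ b')).trans ?_
  rw [div_eq_inv_mul]
  have := abs_ratioLim_sub_le hg hg1 hK hπ hb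
  gcongr

end ratio

/-! ### The amalgamated measure -/

lemma continuous_amalg [TopologicalSpace A] [DiscreteTopology A] [TopologicalSpace B]
    (π : A → B) : Continuous (amalg π) :=
  continuous_pi fun i => continuous_of_discreteTopology.comp (continuous_apply i)

section amalgamated

variable [Fintype A] [TopologicalSpace A] [DiscreteTopology A] [MeasurableSpace A]
  {δ C ρ K : ℝ} {g : (ℕ → A) → ℝ} {π : A → B} {μ : Measure (ℕ → A)}

/-- The integral of `f` over the preimage of a cylinder of `B^ℕ`, for a `g`-measure. -/
lemma integral_fiber (hg : IsWeight δ C ρ g)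
    (hfix : ∀ F : (ℕ → A) → ℝ, Continuous F →
      ∫ x, transfer g Finset.univ F x ∂μ = ∫ x, F x ∂μ)
    (n : ℕ) (b : ℕ → B) {f : (ℕ → A) → ℝ} (hf : Continuous f) :
    ∫ x, (∏ i ∈ Finset.range n, (fiber π (b i) : Set A).indicator 1 (x i)) * f x ∂μ =
      ∫ x, iter g (fun k => fiber π (b k)) n f x ∂μ := by
  classical
  induction n generalizing b f with
  | zero => simp [iter]
  | succ n ih =>
    have hc : Continuous fun x : ℕ → A =>
        (∏ i ∈ Finset.range (n + 1), (fiber π (b i) : Set A).indicator (1 : A → ℝ) (x i)) * f x :=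
      (continuous_finsetProd (Finset.range (n + 1)) fun i _ =>
        (continuous_of_discreteTopology (f := (fiber π (b i) : Set A).indicator (1 : A → ℝ))).comp
          (continuous_apply i)).mul hf
    rw [iter_fiber_succ, ← ih (shift b) (continuous_transfer hg.continuous hf _), ← hfix _ hc]
    congr 1
    funext x
    rw [transfer, transfer, Finset.mul_sum,
      ← Finset.sum_subset (Finset.subset_univ (fiber π (b 0)))]
    · refine Finset.sum_congr rfl fun a ha => ?_
      rw [Finset.prod_range_succ']
      simp only [cons_succ, cons_zero, shift]
      rw [Set.indicator_of_mem (show a ∈ (fiber π (b 0) : Set A) from ha)]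
      simp only [Pi.one_apply]
      ring
    · intro a _ ha
      rw [Finset.prod_range_succ', cons_zero,
        Set.indicator_of_notMem (show a ∉ (fiber π (b 0) : Set A) from ha)]
      ring

variable [BorelSpace A] [Finite B] [TopologicalSpace B] [DiscreteTopology B] [MeasurableSpace B]
  [BorelSpace B]

lemma map_amalg_cylinder (hg : IsWeight δ C ρ g)
    (hfix : ∀ F : (ℕ → A) → ℝ, Continuous F →
      ∫ x, transfer g Finset.univ F x ∂μ = ∫ x, F x ∂μ) (n : ℕ) (b : ℕ → B) :
    (μ.map (amalg π)).real (PiNat.cylinder b n) =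
      ∫ x, iter g (fun k => fiber π (b k)) n (fun _ => 1) x ∂μ := by
  have hb : MeasurableSet (PiNat.cylinder b n) := (PiNat.isOpen_cylinder _ b n).measurableSet
  have hm : Measurable (amalg π) := (continuous_amalg π).measurable
  rw [map_measureReal_apply hm hb, ← integral_fiber hg hfix n b continuous_const,
    ← integral_indicator_one (hm hb)]
  congr 1
  funext x
  rw [mul_one]
  by_cases hx : ∀ i < n, π (x i) = b i
  · rw [Set.indicator_of_mem (by exact hx), Pi.one_apply, Finset.prod_eq_one]
    intro i hi
    exact Set.indicator_of_mem
      (show x i ∈ (fiber π (b i) : Set A) from mem_fiber.2 (hx i (Finset.mem_range.1 hi))) _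
  · rw [Set.indicator_of_notMem (by exact hx)]
    push Not at hx
    obtain ⟨i, hi, hxi⟩ := hx
    refine (Finset.prod_eq_zero (Finset.mem_range.2 hi) ?_).symm
    exact Set.indicator_of_notMem
      (show x i ∉ (fiber π (b i) : Set A) from fun h => hxi (mem_fiber.1 h)) _

variable [IsProbabilityMeasure μ]

lemma mul_map_amalg_cylinder_le (hg : IsWeight δ C ρ g) (hπ : Function.Surjective π)
    (hfix : ∀ F : (ℕ → A) → ℝ, Continuous F →
      ∫ x, transfer g Finset.univ F x ∂μ = ∫ x, F x ∂μ) (n : ℕ) (b : ℕ → B) :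
    δ * (μ.map (amalg π)).real (PiNat.cylinder (shift b) n) ≤
      (μ.map (amalg π)).real (PiNat.cylinder b (n + 1)) := by
  rw [map_amalg_cylinder hg hfix, map_amalg_cylinder hg hfix, ← integral_const_mul]
  have hc := fun (b : ℕ → B) n => continuous_iter hg.continuous
    (continuous_const (y := (1 : ℝ))) (fun k => fiber π (b k)) n
  exact integral_mono (integrable_of_continuous μ ((hc _ _).const_mul δ))
    (integrable_of_continuous μ (hc _ _)) fun x => mul_iter_fiber_le hg hπ n b x

lemma map_amalg_cylinder_pos (hg : IsWeight δ C ρ g) (hπ : Function.Surjective π)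
    (hfix : ∀ F : (ℕ → A) → ℝ, Continuous F →
      ∫ x, transfer g Finset.univ F x ∂μ = ∫ x, F x ∂μ) (n : ℕ) (b : ℕ → B) :
    0 < (μ.map (amalg π)).real (PiNat.cylinder b n) := by
  have hm : Measurable (amalg π) := (continuous_amalg π).measurable
  have := Measure.isProbabilityMeasure_map (μ := μ) hm.aemeasurable
  induction n generalizing b with
  | zero => simp
  | succ n ih =>
    exact (mul_pos hg.δ_pos (ih (shift b))).trans_le (mul_map_amalg_cylinder_le hg hπ hfix n b)

variable [Nonempty A]

lemma abs_ratioLim_sub_map_amalg_le (hg : IsWeight δ C ρ g)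
    (hg1 : ∀ x, ∑ a, g (cons a x) = 1) (hK : 2 * C ≤ (1 - ρ) * K) (hπ : Function.Surjective π)
    (hfix : ∀ F : (ℕ → A) → ℝ, Continuous F →
      ∫ x, transfer g Finset.univ F x ∂μ = ∫ x, F x ∂μ) (n : ℕ) (b : ℕ → B) :
    |ratioLim g π b - (μ.map (amalg π)).real (PiNat.cylinder b (n + 1)) /
      (μ.map (amalg π)).real (PiNat.cylinder (shift b) n)| ≤ rate K ρ ^ n := by
  have hpos := map_amalg_cylinder_pos hg hπ hfix n (shift b) (μ := μ)
  have hc := fun (b : ℕ → B) n => continuous_iter hg.continuous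
    (continuous_const (y := (1 : ℝ))) (fun k => fiber π (b k)) n
  have hbd : ∀ x, (ratioLim g π b - rate K ρ ^ n) *
        iter g (fun k => fiber π (shift b k)) n (fun _ => 1) x ≤
        iter g (fun k => fiber π (b k)) (n + 1) (fun _ => 1) x ∧
      iter g (fun k => fiber π (b k)) (n + 1) (fun _ => 1) x ≤ (ratioLim g π b + rate K ρ ^ n) *
        iter g (fun k => fiber π (shift b k)) n (fun _ => 1) x := fun x => by
    have h1 := abs_le.1 (abs_ratioLim_sub_ratioApprox_le hg hg1 hK hπ n b x)
    have h2 := iter_fiber_pos hg hπ n (shift b) x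
    rw [← le_div_iff₀ h2, ← div_le_iff₀ h2]
    rw [ratioApprox] at h1
    constructor <;> linarith [h1.1, h1.2]
  have h1 := integral_mono (integrable_of_continuous μ ((hc (shift b) n).const_mul _))
    (integrable_of_continuous μ (hc b (n + 1))) fun x => (hbd x).1
  have h2 := integral_mono (integrable_of_continuous μ (hc b (n + 1)))
    (integrable_of_continuous μ ((hc (shift b) n).const_mul _)) fun x => (hbd x).2
  rw [integral_const_mul, ← map_amalg_cylinder hg hfix, ← map_amalg_cylinder hg hfix,
    ← le_div_iff₀ hpos] at h1
  rw [integral_const_mul, ← map_amalg_cylinder hg hfix, ← map_amalg_cylinder hg hfix,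
    ← div_le_iff₀ hpos] at h2
  rw [abs_le]
  constructor <;> linarith

lemma abs_amalgPotential_sub_logRatio_le (hg : IsWeight δ C ρ g)
    (hg1 : ∀ x, ∑ a, g (cons a x) = 1) (hK : 2 * C ≤ (1 - ρ) * K) (hπ : Function.Surjective π)
    (hfix : ∀ F : (ℕ → A) → ℝ, Continuous F →
      ∫ x, transfer g Finset.univ F x ∂μ = ∫ x, F x ∂μ) (n : ℕ) (b : ℕ → B) :
    |amalgPotential g π b - logRatio (μ.map (amalg π)) b n| ≤ δ⁻¹ * rate K ρ ^ n := by
  have hδ := hg.δ_pos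
  have hpos := map_amalg_cylinder_pos hg hπ hfix n (shift b) (μ := μ)
  refine (abs_log_sub_log_le hδ (le_ratioLim hg hg1 hK hπ b) ?_).trans ?_
  · rw [le_div_iff₀ hpos]
    exact mul_map_amalg_cylinder_le hg hπ hfix n b
  · rw [div_eq_inv_mul]
    have := abs_ratioLim_sub_map_amalg_le hg hg1 hK hπ hfix n b
    gcongr

/-- Telescoping `log ν[b_0^{n-1}]` into logarithmic quotients: the errors form a geometric
series. -/
lemma abs_birkhoffSum_sub_log_le (hg : IsWeight δ C ρ g)
    (hg1 : ∀ x, ∑ a, g (cons a x) = 1) (hK : 2 * C ≤ (1 - ρ) * K) (hπ : Function.Surjective π)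
    (hfix : ∀ F : (ℕ → A) → ℝ, Continuous F →
      ∫ x, transfer g Finset.univ F x ∂μ = ∫ x, F x ∂μ) (n : ℕ) (b : ℕ → B) :
    |birkhoffSum shift (amalgPotential g π) n b -
      Real.log ((μ.map (amalg π)).real (PiNat.cylinder b n))| ≤
        δ⁻¹ * (1 - rate K ρ)⁻¹ := by
  have hr0 := (rate_pos hg.ρ_pos hg.ρ_lt (hg.K_nonneg hK) (K := K)).le
  have hr1 : rate K ρ < 1 := rate_lt_one hg.ρ_pos hg.ρ_lt
  have hδ := hg.δ_pos
  have key : |birkhoffSum shift (amalgPotential g π) n b -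
      Real.log ((μ.map (amalg π)).real (PiNat.cylinder b n))| ≤
        δ⁻¹ * ∑ k ∈ Finset.range n, rate K ρ ^ k := by
    induction n generalizing b with
    | zero =>
      have hm : Measurable (amalg π) := (continuous_amalg π).measurable
      have := Measure.isProbabilityMeasure_map (μ := μ) hm.aemeasurable
      simp
    | succ n ih =>
      have p1 := map_amalg_cylinder_pos hg hπ hfix (n + 1) b (μ := μ)
      have p2 := map_amalg_cylinder_pos hg hπ hfix n (shift b) (μ := μ)
      have h1 := abs_amalgPotential_sub_logRatio_le hg hg1 hK hπ hfix n b (μ := μ)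
      have h2 := ih (shift b)
      rw [logRatio, Real.log_div p1.ne' p2.ne'] at h1
      rw [birkhoffSum_succ', Finset.sum_range_succ, mul_add]
      rw [abs_le] at h1 h2 ⊢
      constructor <;> linarith [h1.1, h1.2, h2.1, h2.2]
  refine key.trans ?_
  have h5 : ∑ k ∈ Finset.range n, rate K ρ ^ k ≤ (1 - rate K ρ)⁻¹ := by
    rw [← tsum_geometric_of_lt_one hr0 hr1]
    exact (summable_geometric_of_lt_one hr0 hr1).sum_le_tsum _ fun k _ => pow_nonneg hr0 k
  gcongr

end amalgamated

/-! ### Pressure -/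

section pressure

/-- The sum over points of period `n` is a sum over words of length `n`. -/
lemma finsum_ptsOfPeriod [Fintype B] {n : ℕ} (hn : 0 < n) (F : (ℕ → B) → ℝ) :
    ∑ᶠ a ∈ Function.ptsOfPeriod (shift (A := B)) n, F a =
      ∑ w : Fin n → B, F fun i => w ⟨i % n, Nat.mod_lt i hn⟩ := by
  rw [← finsum_eq_sum_of_fintype, ← finsum_mem_univ fun w : Fin n → B =>
    F fun i => w ⟨i % n, Nat.mod_lt i hn⟩]
  refine (finsum_mem_eq_of_bijOn (fun (w : Fin n → B) (i : ℕ) => w ⟨i % n, Nat.mod_lt i hn⟩)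
    ⟨fun w _ => ?_, fun w _ w' _ h => ?_, fun a ha => ?_⟩ fun _ _ => rfl).symm
  · change shift^[n] _ = _
    funext i
    simp [shift_iterate_apply]
  · funext i
    have := congrFun h i
    simpa [Nat.mod_eq_of_lt i.2] using this
  · have ha' : ∀ i, a (i + n) = a i := fun i => by
      rw [← shift_iterate_apply n a i]
      exact congrFun (show shift^[n] a = a from ha) i
    refine ⟨fun i => a i, trivial, ?_⟩
    funext i
    change a (i % n) = a i
    exact (show Function.Periodic a n from ha').map_mod_nat i

/-- A potential whose Birkhoff sums are within a constant of the logarithms of the cylinder masses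
of a probability measure is normalized. -/
lemma isNormalized_of_abs_le [Finite B] [TopologicalSpace B] [DiscreteTopology B]
    [MeasurableSpace B] [BorelSpace B] {ν : Measure (ℕ → B)} [IsProbabilityMeasure ν]
    {φ : (ℕ → B) → ℝ} {E : ℝ}
    (hpos : ∀ n b, 0 < ν.real (PiNat.cylinder b n))
    (hE : ∀ n b, |birkhoffSum shift φ n b - Real.log (ν.real (PiNat.cylinder b n))| ≤ E) :
    IsNormalized φ := by
  have := Fintype.ofFinite B
  obtain ⟨b₀⟩ : Nonempty (ℕ → B) := by
    by_contra h
    have := not_nonempty_iff.1 h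
    have h1 : ν Set.univ = 1 := measure_univ
    rw [Set.univ_eq_empty_iff.2 this] at h1
    simp at h1
  have hZ : ∀ n : ℕ, 0 < n → |Real.log (∑ᶠ a ∈ Function.ptsOfPeriod (shift (A := B)) n,
      Real.exp (birkhoffSum shift φ n a))| ≤ E := fun n hn => by
    rw [finsum_ptsOfPeriod hn]
    have hsum : ∑ w : Fin n → B,
        ν.real (PiNat.cylinder (fun i => w ⟨i % n, Nat.mod_lt i hn⟩) n) = 1 := by
      rw [← sum_cylinder ν n b₀]
      refine Finset.sum_congr rfl fun w _ => ?_
      congr 1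
      refine PiNat.mem_cylinder_iff_eq.1 fun i hi => ?_
      rw [app_of_lt _ _ hi]
      simp [Nat.mod_eq_of_lt hi]
    have hb : ∀ b, Real.exp (-E) * ν.real (PiNat.cylinder b n) ≤
        Real.exp (birkhoffSum shift φ n b) ∧
        Real.exp (birkhoffSum shift φ n b) ≤ Real.exp E * ν.real (PiNat.cylinder b n) :=
      fun b => by
        have h1 := abs_le.1 (hE n b)
        have h2 := Real.exp_log (hpos n b)
        rw [← h2, ← Real.exp_add, ← Real.exp_add, Real.exp_le_exp, Real.exp_le_exp]
        constructor <;> linarith [h1.1, h1.2]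
    set Z := ∑ w : Fin n → B,
      Real.exp (birkhoffSum shift φ n fun i => w ⟨i % n, Nat.mod_lt i hn⟩) with hZdef
    have l1 : Real.exp (-E) ≤ Z := by
      have := Finset.sum_le_sum fun (w : Fin n → B) (_ : w ∈ Finset.univ) =>
        (hb fun i => w ⟨i % n, Nat.mod_lt i hn⟩).1
      rwa [← Finset.mul_sum, hsum, mul_one] at this
    have l2 : Z ≤ Real.exp E := by
      have := Finset.sum_le_sum fun (w : Fin n → B) (_ : w ∈ Finset.univ) =>
        (hb fun i => w ⟨i % n, Nat.mod_lt i hn⟩).2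
      rwa [← Finset.mul_sum, hsum, mul_one] at this
    have hZ0 := (Real.exp_pos _).trans_le l1
    rw [abs_le]
    exact ⟨(Real.le_log_iff_exp_le hZ0).2 l1, (Real.log_le_iff_le_exp hZ0).2 l2⟩
  have ht : Tendsto (fun n : ℕ => (1 / (n : ℝ)) * Real.log
      (∑ᶠ a ∈ Function.ptsOfPeriod (shift (A := B)) n, Real.exp (birkhoffSum shift φ n a)))
      atTop (𝓝 0) := by
    have h0 : Tendsto (fun n : ℕ => E / (n : ℝ)) atTop (𝓝 0) :=
      tendsto_const_div_atTop_nhds_zero_nat E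
    refine squeeze_zero_norm' ?_ h0
    filter_upwards [eventually_gt_atTop 0] with n hn
    rw [norm_mul, Real.norm_eq_abs, Real.norm_eq_abs, abs_of_nonneg (by positivity), one_div,
      div_eq_inv_mul]
    have := hZ n hn
    gcongr
  exact ((continuous_coe_real_ereal.tendsto 0).comp ht).limsup_eq

end pressure

/-! ### Dependence on the weight -/

section perturbation

/-- Limits can be interchanged when the inner ones are uniform. -/
lemma tendsto_of_uniform {L : ℕ → ℝ} {L' : ℝ} {a : ℕ → ℕ → ℝ} {a' e : ℕ → ℝ}
    (he : Tendsto e atTop (𝓝 0)) (h : ∀ᶠ r in atTop, ∀ n, |L r - a r n| ≤ e n)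
    (h' : ∀ n, |L' - a' n| ≤ e n) (ha : ∀ n, Tendsto (fun r => a r n) atTop (𝓝 (a' n))) :
    Tendsto L atTop (𝓝 L') := by
  refine Metric.tendsto_nhds.2 fun ε hε => ?_
  obtain ⟨n, hn⟩ := (he.eventually (gt_mem_nhds (show 0 < ε / 3 by positivity))).exists
  filter_upwards [h, Metric.tendsto_nhds.1 (ha n) (ε / 3) (by positivity)] with r h1 h2
  have h3 := h1 n
  have h4 := h' n
  rw [Real.dist_eq] at h2 ⊢
  rw [abs_lt] at h2 ⊢
  rw [abs_le] at h3 h4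
  constructor <;> linarith [h2.1, h2.2, h3.1, h3.2, h4.1, h4.2]

lemma tendsto_iter {u : ℕ → (ℕ → A) → ℝ} {u' : (ℕ → A) → ℝ}
    (hu : ∀ x, Tendsto (fun r => u r x) atTop (𝓝 (u' x))) (S : ℕ → Finset A) (n : ℕ)
    (f : (ℕ → A) → ℝ) (x : ℕ → A) :
    Tendsto (fun r => iter (u r) S n f x) atTop (𝓝 (iter u' S n f x)) := by
  induction n generalizing x with
  | zero => exact tendsto_const_nhds
  | succ n ih => exact tendsto_finsetSum _ fun a _ => (hu _).mul (ih _)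

variable [Fintype A] [Nonempty A] {δ C ρ K : ℝ} {u : ℕ → (ℕ → A) → ℝ} {u' : (ℕ → A) → ℝ}

lemma tendsto_gfun (hu : ∀ᶠ r in atTop, IsWeight δ C ρ (u r)) (hu' : IsWeight δ C ρ u')
    (hK : 2 * C ≤ (1 - ρ) * K) (h : ∀ x, Tendsto (fun r => u r x) atTop (𝓝 (u' x)))
    (x : ℕ → A) : Tendsto (fun r => gfun (u r) x) atTop (𝓝 (gfun u' x)) := by
  refine tendsto_of_uniform (tendsto_rate_pow hu' hK (Real.exp (2 * K)))
    (hu.mono fun r hr n => abs_gfun_sub_le hr hK n x) (fun n => abs_gfun_sub_le hu' hK n x)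
    fun n => ?_
  exact ((h x).mul (tendsto_iter h _ _ _ _)).div (tendsto_iter h _ _ _ _)
    (ruelle_one_pos hu' _ _).ne'

lemma tendsto_ratioLim {π : A → B} (hπ : Function.Surjective π)
    (hu : ∀ᶠ r in atTop, IsWeight δ C ρ (u r) ∧ ∀ x, ∑ a, u r (cons a x) = 1)
    (hu' : IsWeight δ C ρ u') (hu1 : ∀ x, ∑ a, u' (cons a x) = 1)
    (hK : 2 * C ≤ (1 - ρ) * K) (h : ∀ x, Tendsto (fun r => u r x) atTop (𝓝 (u' x)))
    (b : ℕ → B) : Tendsto (fun r => ratioLim (u r) π b) atTop (𝓝 (ratioLim u' π b)) := by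
  have x₀ : ℕ → A := fun _ => Classical.arbitrary A
  refine tendsto_of_uniform (by simpa using tendsto_rate_pow hu' hK 1)
    (hu.mono fun r hr n => abs_ratioLim_sub_ratioApprox_le hr.1 hr.2 hK hπ n b x₀)
    (fun n => abs_ratioLim_sub_ratioApprox_le hu' hu1 hK hπ n b x₀) fun n => ?_
  exact (tendsto_iter h _ _ _ _).div (tendsto_iter h _ _ _ _) (iter_fiber_pos hu' hπ _ _ _).ne'

end perturbation

/-! ### Gibbs measures of Hölder potentials and of their approximants -/

lemma abs_sub_le_of_var_le {ψ : (ℕ → A) → ℝ} {n : ℕ} {c : ℝ} (hc : 0 ≤ c)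
    (h : var n ψ ≤ ENNReal.ofReal c) {x y : ℕ → A} (hxy : ∀ i ≤ n, x i = y i) :
    |ψ x - ψ y| ≤ c := by
  rw [← ENNReal.ofReal_le_ofReal_iff hc]
  refine le_trans ?_ h
  exact le_iSup₂_of_le x y (le_iSup (fun _ => ENNReal.ofReal |ψ x - ψ y|) hxy)

lemma var_le_ofReal {ψ : (ℕ → B) → ℝ} {n : ℕ} {c : ℝ}
    (h : ∀ x y : ℕ → B, (∀ i ≤ n, x i = y i) → |ψ x - ψ y| ≤ c) :
    var n ψ ≤ ENNReal.ofReal c :=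
  iSup₂_le fun x y => iSup_le fun hxy => ENNReal.ofReal_le_ofReal (h x y hxy)

lemma isWeight_exp {ψ : (ℕ → A) → ℝ} {m C ρ : ℝ} (hC : 0 ≤ C) (hρ : ρ ∈ Set.Ioo (0 : ℝ) 1)
    (hm : ∀ x, |ψ x| ≤ m)
    (h : ∀ n x y, (∀ i ≤ n, x i = y i) → |ψ x - ψ y| ≤ C * ρ ^ n) :
    IsWeight (Real.exp (-m)) C ρ (fun x => Real.exp (ψ x)) := by
  refine ⟨Real.exp_pos _, hC, hρ.1, hρ.2, fun x => ?_, fun x => ?_, fun n x y hxy => ?_⟩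
  · exact Real.exp_le_exp.2 (abs_le.1 (hm x)).1
  · rw [← Real.exp_neg, neg_neg]
    exact Real.exp_le_exp.2 (abs_le.1 (hm x)).2
  · rw [← Real.exp_add, Real.exp_le_exp]
    linarith [(abs_le.1 (h n x y hxy)).2]

lemma IsApproximant.abs_sub_le {ψ ψ' : (ℕ → A) → ℝ} {r : ℕ} {c : ℝ} (hc : 0 ≤ c)
    (h : IsApproximant r ψ ψ') (hvar : var r ψ ≤ ENNReal.ofReal c) (x : ℕ → A) :
    |ψ x - ψ' x| ≤ c := by
  rw [← ENNReal.ofReal_le_ofReal_iff hc]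
  exact (h.2 x).trans hvar

/-- The approximants of a Hölder potential are Hölder continuous with uniform constants. -/
lemma IsApproximant.isWeight_exp {ψ ψ' : (ℕ → A) → ℝ} {r : ℕ} {m C ρ : ℝ} (hC : 0 ≤ C)
    (hρ : ρ ∈ Set.Ioo (0 : ℝ) 1) (hm : ∀ x, |ψ x| ≤ m)
    (hvar : ∀ n, var n ψ ≤ ENNReal.ofReal (C * ρ ^ n)) (h : IsApproximant r ψ ψ') :
    IsWeight (Real.exp (-(m + C))) (3 * C) ρ (fun x => Real.exp (ψ' x)) := by
  have hp : ∀ n, 0 ≤ C * ρ ^ n := fun n => mul_nonneg hC (pow_nonneg hρ.1.le n)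
  have hr : ∀ x, |ψ x - ψ' x| ≤ C * ρ ^ r := h.abs_sub_le (hp r) (hvar r)
  refine Amalgamation.isWeight_exp (by positivity) hρ (fun x => ?_) fun n x y hxy => ?_
  · have h1 := abs_le.1 (hr x)
    have h2 := abs_le.1 (hm x)
    have h3 : C * ρ ^ r ≤ C := mul_le_of_le_one_right hC (pow_le_one₀ hρ.1.le hρ.2.le)
    rw [abs_le]
    constructor <;> linarith [h1.1, h1.2, h2.1, h2.2]
  · rcases le_or_gt r n with hrn | hrn
    · rw [h.1 x y fun i hi => hxy i (hi.trans hrn), sub_self, abs_zero]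
      have := hp n
      linarith
    · have h1 := abs_le.1 (hr x)
      have h2 := abs_le.1 (hr y)
      have h3 := abs_le.1 (abs_sub_le_of_var_le (hp n) (hvar n) hxy)
      have h4 : C * ρ ^ r ≤ C * ρ ^ n :=
        mul_le_mul_of_nonneg_left (pow_le_pow_of_le_one hρ.1.le hρ.2.le hrn.le) hC
      rw [abs_le]
      constructor <;> linarith [h1.1, h1.2, h2.1, h2.2, h3.1, h3.2]

/-- A Gibbs measure is a `g`-measure for the normalized weight of its potential. -/
lemma IsGibbs.integral_transfer [Fintype A] [Nonempty A] [TopologicalSpace A] [DiscreteTopology A]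
    [MeasurableSpace A] [BorelSpace A] {μ : Measure (ℕ → A)} {ψ : (ℕ → A) → ℝ}
    (hμ : IsGibbs μ ψ) {δ C ρ K : ℝ} (hu : IsWeight δ C ρ fun x => Real.exp (ψ x))
    (hK : 2 * C ≤ (1 - ρ) * K) {F : (ℕ → A) → ℝ} (hF : Continuous F) :
    ∫ x, transfer (gfun fun x => Real.exp (ψ x)) Finset.univ F x ∂μ = ∫ x, F x ∂μ := by
  have := hμ.isProbabilityMeasure
  obtain ⟨D, hD1, P, hD⟩ := hμ.gibbs
  have hD0 : 0 < D := by linarith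
  have key : ∀ n x, D⁻¹ * (weightProd (fun x => Real.exp (ψ x)) n x * Real.exp (-(n * P))) ≤
      μ.real (PiNat.cylinder x n) ∧ μ.real (PiNat.cylinder x n) ≤
      D * (weightProd (fun x => Real.exp (ψ x)) n x * Real.exp (-(n * P))) := fun n x => by
    cases n with
    | zero =>
      simp only [weightProd, Finset.range_zero, Finset.prod_empty, Nat.cast_zero, zero_mul,
        neg_zero, Real.exp_zero, mul_one, PiNat.cylinder_zero, probReal_univ]
      exact ⟨inv_le_one_of_one_le₀ hD1, hD1⟩
    | succ n =>
      have h := hD n x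
      rw [Set.mem_Icc, le_div_iff₀ (Real.exp_pos _), div_le_iff₀ (Real.exp_pos _)] at h
      rw [weightProd_exp, ← Real.exp_add]
      push_cast
      rwa [← sub_eq_add_neg]
  exact Amalgamation.integral_transfer (isWeight_gfun hu hK) (sum_gfun hu hK) hμ.invariant
    (by positivity : 0 ≤ D ^ 3)
    (exists_le_weightProd_gfun hu hK hD0 (fun n x => (key n x).1) fun n x => (key n x).2) hF

end

end Amalgamation

theorem theorem3p1 {A B : Type*} [Finite A] [Finite B]
    [TopologicalSpace A] [DiscreteTopology A] [MeasurableSpace A] [BorelSpace A]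
    [TopologicalSpace B] [DiscreteTopology B] [MeasurableSpace B] [BorelSpace B]
    (hB : 2 ≤ Nat.card B) (hAB : Nat.card B < Nat.card A)
    (π : A → B) (hπ : Function.Surjective π)
    (ψ : (ℕ → A) → ℝ) (hψ : Amalgamation.IsHolder ψ)
    (μ : Measure (ℕ → A)) (hμ : Amalgamation.IsGibbs μ ψ) :
    ∃ φ : (ℕ → B) → ℝ,
      Amalgamation.IsGibbs (μ.map (Amalgamation.amalg π)) φ ∧
      (μ.map (Amalgamation.amalg π)).support = Set.univ ∧
      (∃ D > (0 : ℝ), ∃ c > (0 : ℝ), ∀ n : ℕ,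
        Amalgamation.var n φ ≤ ENNReal.ofReal (D * Real.exp (-c * √(n : ℝ)))) ∧
      Amalgamation.IsNormalized φ ∧
      (∀ (ψr : ℕ → (ℕ → A) → ℝ) (μr : ℕ → Measure (ℕ → A)),
        (∀ r ≥ 1, Amalgamation.IsApproximant r ψ (ψr r)) →
        (∀ r ≥ 1, Amalgamation.IsGibbs (μr r) (ψr r)) →
        ∃ φr : ℕ → (ℕ → B) → ℝ,
          (∀ r ≥ 1, ∀ b : ℕ → B,
            Tendsto (fun n => Amalgamation.logRatio ((μr r).map (Amalgamation.amalg π)) b n)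
              atTop (𝓝 (φr r b))) ∧
          ∀ b : ℕ → B, Tendsto (fun r => φr r b) atTop (𝓝 (φ b))) ∧
      (Amalgamation.IsLocConst ψ →
        ∃ C > (0 : ℝ), ∃ ϑ ∈ Set.Ioo (0 : ℝ) 1, ∀ n : ℕ,
          Amalgamation.var n φ ≤ ENNReal.ofReal (C * ϑ ^ n)) := by
  open Amalgamation in
  have := Fintype.ofFinite A
  have hA : Nonempty A := (Nat.card_pos_iff.1 (by omega)).1
  have := hμ.isProbabilityMeasure
  obtain ⟨C, hC, ρ, hρ, hvar⟩ := hψ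
  obtain ⟨m, -, hm⟩ := exists_forall_abs_le hμ.continuous
  have hself : ∀ n x y, (∀ i ≤ n, x i = y i) → |ψ x - ψ y| ≤ 3 * C * ρ ^ n :=
    fun n x y hxy => by
      have h0 : 0 ≤ C * ρ ^ n := mul_nonneg hC.le (pow_nonneg hρ.1.le n)
      have := abs_sub_le_of_var_le h0 (hvar n) hxy
      linarith
  have hu : IsWeight (Real.exp (-(m + C))) (3 * C) ρ (fun x => Real.exp (ψ x)) :=
    isWeight_exp (by positivity) hρ (fun x => (hm x).trans (by linarith)) hself
  -- distortion constants for the weight `exp ψ` and for its normalization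
  have hρ1 : (1 - ρ) ≠ 0 := by linarith [hρ.2]
  obtain ⟨K, hK⟩ : ∃ K, 2 * (3 * C) ≤ (1 - ρ) * K :=
    ⟨2 * (3 * C) / (1 - ρ), by field_simp; exact le_rfl⟩
  obtain ⟨K', hK'⟩ : ∃ K', 2 * (3 * C + 2 * K) ≤ (1 - ρ) * K' :=
    ⟨2 * (3 * C + 2 * K) / (1 - ρ), by field_simp; exact le_rfl⟩
  set g := gfun fun x => Real.exp (ψ x) with hgdef
  have hg := isWeight_gfun hu hK
  have hg1 := sum_gfun hu hK
  have hfix := fun (F : (ℕ → A) → ℝ) (hF : Continuous F) => hμ.integral_transfer hu hK hF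
  rw [← hgdef] at hg hg1 hfix
  set δ := lowerConst A (Real.exp (-(m + C))) K
  have hδ := hg.δ_pos
  have hκ0 := rate_pos hg.ρ_pos hg.ρ_lt (hg.K_nonneg hK')
  have hκ1 := rate_lt_one hg.ρ_pos hg.ρ_lt (K := K')
  set κ := rate K' ρ with hκ
  set ν := μ.map (amalg π) with hν
  have hπc : Continuous (amalg π) := continuous_amalg π
  have hνp : IsProbabilityMeasure ν := Measure.isProbabilityMeasure_map hπc.measurable.aemeasurable
  have hpos : ∀ n b, 0 < ν.real (PiNat.cylinder b n) := map_amalg_cylinder_pos hg hπ hfix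
  have hE := abs_birkhoffSum_sub_log_le hg hg1 hK' hπ hfix
  rw [← hν, ← hκ] at hE
  have hφ : ∀ n, var n (amalgPotential g π) ≤ ENNReal.ofReal (δ⁻¹ * κ ^ n) := fun n =>
    var_le_ofReal fun b b' hb => abs_amalgPotential_sub_le hg hg1 hK' hπ hb
  refine ⟨amalgPotential g π, ⟨?_, hνp, ?_, ?_⟩, ?_, ?_, isNormalized_of_abs_le hpos hE, ?_, ?_⟩
  · refine continuous_of_forall_exists fun ε hε => ?_
    obtain ⟨n, hn⟩ := ((tendsto_rate_pow hg hK' δ⁻¹).eventually (gt_mem_nhds hε)).exists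
    exact ⟨n + 1, fun b b' hb => (abs_amalgPotential_sub_le hg hg1 hK' hπ (n := n)
      fun i hi => hb i (by omega)).trans_lt hn⟩
  · refine ⟨continuous_shift.measurable, ?_⟩
    rw [hν, Measure.map_map continuous_shift.measurable hπc.measurable]
    conv_rhs => rw [← hμ.invariant.map_eq,
      Measure.map_map hπc.measurable continuous_shift.measurable]
    rfl
  · set E := δ⁻¹ * (1 - κ)⁻¹ with hEdef
    have hE0 : 0 ≤ E := mul_nonneg (by positivity) (inv_nonneg.2 (by linarith))
    refine ⟨Real.exp E, Real.one_le_exp hE0, 0, fun n b => ?_⟩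
    have h := abs_le.1 (hE (n + 1) b)
    rw [mul_zero, sub_zero, ← Real.exp_log (hpos (n + 1) b), ← Real.exp_sub, ← Real.exp_neg]
    exact ⟨Real.exp_le_exp.2 (by linarith), Real.exp_le_exp.2 (by linarith)⟩
  · refine Set.eq_univ_of_forall fun b => (Measure.mem_support_iff_forall b).2 fun U hU => ?_
    obtain ⟨_, ⟨z, n, rfl⟩, hb, hsub⟩ :=
      (PiNat.isTopologicalBasis_cylinders (fun _ : ℕ => B)).mem_nhds_iff.1 hU
    exact (ENNReal.toReal_pos_iff.1 (hpos n z)).1.trans_le (measure_mono hsub)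
  · -- `√n ≤ n` for natural numbers, so the exponential rate is stronger than the stretched one
    refine ⟨δ⁻¹, by positivity, -Real.log κ, by linarith [Real.log_neg hκ0 hκ1], fun n =>
      (hφ n).trans (ENNReal.ofReal_le_ofReal ?_)⟩
    have h1 : √(n : ℝ) ≤ n := by
      rw [Real.sqrt_le_left (by positivity)]
      exact_mod_cast Nat.le_self_pow two_ne_zero n
    have h2 : κ ^ n = Real.exp (n * Real.log κ) := by
      rw [Real.exp_nat_mul, Real.exp_log hκ0]
    rw [h2, neg_neg]
    have h3 := Real.log_neg hκ0 hκ1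
    gcongr δ⁻¹ * Real.exp ?_
    nlinarith
  · intro ψr μr happ hμr
    have hw : ∀ r ≥ 1, IsWeight (Real.exp (-(m + C))) (3 * C) ρ (fun x => Real.exp (ψr r x)) :=
      fun r hr => (happ r hr).isWeight_exp hC.le hρ hm hvar
    refine ⟨fun r => amalgPotential (gfun fun x => Real.exp (ψr r x)) π, fun r hr b => ?_,
      fun b => ?_⟩
    · have := (hμr r hr).isProbabilityMeasure
      have hgr := isWeight_gfun (hw r hr) hK
      have h := abs_amalgPotential_sub_logRatio_le hgr (sum_gfun (hw r hr) hK) hK' hπ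
        (fun F hF => (hμr r hr).integral_transfer (hw r hr) hK hF)
      rw [tendsto_iff_norm_sub_tendsto_zero]
      refine squeeze_zero (fun _ => norm_nonneg _) (fun n => ?_) (tendsto_rate_pow hgr hK' δ⁻¹)
      rw [norm_sub_rev]
      exact h n b
    · have hlim : ∀ x, Tendsto (fun r => ψr r x) atTop (𝓝 (ψ x)) := fun x => by
        rw [tendsto_iff_norm_sub_tendsto_zero]
        refine squeeze_zero' (g := fun r : ℕ => C * ρ ^ r)
          (Eventually.of_forall fun _ => norm_nonneg _) ?_ ?_
        · filter_upwards [eventually_ge_atTop 1] with r hr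
          rw [norm_sub_rev]
          exact (happ r hr).abs_sub_le (mul_nonneg hC.le (pow_nonneg hρ.1.le r)) (hvar r) x
        · simpa using (tendsto_pow_atTop_nhds_zero_of_lt_one hρ.1.le hρ.2).const_mul C
      have hwe := (eventually_ge_atTop 1).mono hw
      have hlimg : ∀ x, Tendsto (fun r => gfun (fun y => Real.exp (ψr r y)) x) atTop (𝓝 (g x)) :=
        tendsto_gfun hwe hu hK fun x => (Real.continuous_exp.tendsto _).comp (hlim x)
      refine Tendsto.log ?_ (hδ.trans_le (le_ratioLim hg hg1 hK' hπ b)).ne'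
      exact tendsto_ratioLim hπ (hwe.mono fun r hr => ⟨isWeight_gfun hr hK, sum_gfun hr hK⟩) hg hg1
        hK' hlimg b
  · exact fun _ => ⟨δ⁻¹, by positivity, κ, ⟨hκ0, hκ1⟩, hφ⟩
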